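/- Let $\Gamma$ be a countable discrete group and let $(A,\tau)$ be an amenable tracial von Neumann algebra (that is, $\tau$ is a faithful normal tracial state on $A$) with separable $L^2(A,\tau)$, acting on $L^2(A,\tau)$ by left multiplication. Let $\sigma:\Gamma\curvearrowright A$ be an action by $\tau$-preserving $*$-automorphisms. On $\ell^2(\Gamma,L^2(A,\tau))$ consider the operators $(\pi(a)\xi)(h)=\sigma_h^{-1}(a)\xi(h)$ for $a\in A$ and the unitaries $(\lambda_g\xi)(h)=\xi(g^{-1}h)$ for $g\in\Gamma$. For a subgroup $\Lambda\le\Gamma$, let $\Lambda\ltimes A$ be the von Neumann algebra generated by $\pi(A)$ and $\{\lambda_g: g\in\Lambda\}$, and identify $A$ with $\pi(A)\subset\Gamma\ltimes A$. Let $\mathrm{Rad}(\Gamma)$ be the amenable radical of $\Gamma$, i.e. its largest amenable normal subgroup. Call a von Neumann subalgebra $N\subset\Gamma\ltimes A$ $\Gamma$-invariant if $\lambda_gN\lambda_g^*\subset N$ for all $g\in\Gamma$, and call a von Neumann algebra on a Hilbert space $H$ amenable if there is a conditional expectation from $B(H)$ onto it. Let $N$ be an amenable $\Gamma$-invariant von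 Neumann algebra with $A\subset N\subset\Gamma\ltimes A$. Then $N\subset\mathrm{Rad}(\Gamma)\ltimes A$. In particular, if $\mathrm{Rad}(\Gamma)=\{e\}$, then $A$ is a maximal element, with respect to inclusion, of the set of all amenable $\Gamma$-invariant von Neumann subalgebras of $\Gamma\ltimes A$. -/

import Mathlib

open scoped InnerProductSpace ENNReal

universe u v

noncomputable section

/-! ### Amenable groups and the amenable radical -/

/-- A discrete group is amenable if it carries a finitely additive, left invariant probability
measure defined on all of its subsets. -/
def IsAmenableGroup (G : Type v) [Group G] : Prop :=
  ∃ m : Set G → ℝ, (∀ s, 0 ≤ m s) ∧ m Set.univ = 1 ∧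
    (∀ s t, Disjoint s t → m (s ∪ t) = m s + m t) ∧
    ∀ (g : G) (s : Set G), m ((fun x => g * x) '' s) = m s

/-- The amenable radical: the largest amenable normal subgroup, that is, the supremum in the
lattice of subgroups of all amenable normal subgroups (this supremum is itself amenable). -/
def amenableRadical (G : Type v) [Group G] : Subgroup G :=
  sSup {L : Subgroup G | L.Normal ∧ IsAmenableGroup L}

/-! ### Von Neumann algebras -/

section VonNeumann

variable {H : Type u} [NormedAddCommGroup H] [InnerProductSpace ℂ H] [CompleteSpace H]

/-- The von Neumann algebra generated by a set of operators: the double commutant of the set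
together with the adjoints of its elements. -/
def generatedVonNeumannAlgebra (S : Set (H →L[ℂ] H)) : VonNeumannAlgebra H where
  toStarSubalgebra :=
    StarSubalgebra.centralizer ℂ (StarSubalgebra.centralizer ℂ S : Set (H →L[ℂ] H))
  centralizer_centralizer' := by
    change Set.centralizer (Set.centralizer (SetLike.coe
      (StarSubalgebra.centralizer ℂ (StarSubalgebra.centralizer ℂ S : Set (H →L[ℂ] H))))) =
      SetLike.coe
      (StarSubalgebra.centralizer ℂ (StarSubalgebra.centralizer ℂ S : Set (H →L[ℂ] H)))
    simp only [StarSubalgebra.coe_centralizer_centralizer, Set.centralizer_centralizer_centralizer]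

/-- `E` is a conditional expectation from `B(H)` onto the von Neumann algebra `N`. -/
structure IsConditionalExpectation (N : VonNeumannAlgebra H)
    (E : (H →L[ℂ] H) →ₗ[ℂ] (H →L[ℂ] H)) : Prop where
  map_mem : ∀ T, E T ∈ N
  map_of_mem : ∀ T ∈ N, E T = T
  map_nonneg : ∀ T : H →L[ℂ] H, T.IsPositive → (E T).IsPositive
  map_bimodule : ∀ x ∈ N, ∀ y ∈ N, ∀ T, E (x * T * y) = x * E T * y

/-- A von Neumann algebra on `H` is amenable (equivalently, injective) if there is a, not
necessarily normal, conditional expectation from `B(H)` onto it. -/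
def VonNeumannAlgebra.IsAmenable (N : VonNeumannAlgebra H) : Prop :=
  ∃ E : (H →L[ℂ] H) →ₗ[ℂ] (H →L[ℂ] H), IsConditionalExpectation N E

end VonNeumann

/-- A tracial von Neumann algebra `(A, τ)`, acting by left multiplication on `K = L²(A, τ)`.
The unit vector `vac` is the vector `1̂` of `L²(A, τ)`: the trace is `τ a = ⟪1̂, a 1̂⟫`, and the
vectors `â = a 1̂` are dense. A vector state is normal, and the trace property together with
cyclicity makes it faithful, see `TracialVonNeumannAlgebra.trace_faithful`. -/
structure TracialVonNeumannAlgebra (K : Type u) [NormedAddCommGroup K] [InnerProductSpace ℂ K]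
    [CompleteSpace K] where
  alg : VonNeumannAlgebra K
  vac : K
  norm_vac : ‖vac‖ = 1
  trace_comm : ∀ a ∈ alg, ∀ b ∈ alg, ⟪vac, (a * b) vac⟫_ℂ = ⟪vac, (b * a) vac⟫_ℂ
  cyclic : Dense {ξ : K | ∃ a ∈ alg, a vac = ξ}

namespace TracialVonNeumannAlgebra

variable {K : Type u} [NormedAddCommGroup K] [InnerProductSpace ℂ K] [CompleteSpace K]

/-- The elements of `A`, as a type. -/
abbrev Elem (A : TracialVonNeumannAlgebra K) : Type u := A.alg.toStarSubalgebra

/-- The trace `τ`. -/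
def trace (A : TracialVonNeumannAlgebra K) (a : A.Elem) : ℂ :=
  ⟪A.vac, (a : K →L[ℂ] K) A.vac⟫_ℂ

theorem trace_one (A : TracialVonNeumannAlgebra K) : A.trace 1 = 1 := by
  simp [trace, inner_self_eq_norm_sq_to_K, A.norm_vac]

theorem trace_mul_comm (A : TracialVonNeumannAlgebra K) (a b : A.Elem) :
    A.trace (a * b) = A.trace (b * a) :=
  A.trace_comm a a.2 b b.2

theorem trace_star_mul (A : TracialVonNeumannAlgebra K) (a b : A.Elem) :
    A.trace (star a * b) = ⟪(a : K →L[ℂ] K) A.vac, (b : K →L[ℂ] K) A.vac⟫_ℂ := by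
  change ⟪A.vac, (star (a : K →L[ℂ] K)) ((b : K →L[ℂ] K) A.vac)⟫_ℂ = _
  rw [ContinuousLinearMap.star_eq_adjoint, ContinuousLinearMap.adjoint_inner_right]

theorem trace_faithful (A : TracialVonNeumannAlgebra K) (a : A.Elem)
    (h : A.trace (star a * a) = 0) : a = 0 := by
  rw [trace_star_mul, inner_self_eq_zero] at h
  have key : ∀ b : A.Elem, (a : K →L[ℂ] K) ((b : K →L[ℂ] K) A.vac) = 0 := by
    intro b
    have h1 : A.trace (star (a * b) * (a * b)) = 0 := by
      have e : star (a * b) * (a * b) = star b * (star a * a * b) := by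
        simp only [star_mul, mul_assoc]
      rw [e, A.trace_mul_comm, mul_assoc, mul_assoc, A.trace_star_mul, h, inner_zero_left]
    rw [trace_star_mul, inner_self_eq_zero] at h1
    exact h1
  apply Subtype.ext
  apply ContinuousLinearMap.coeFn_injective
  refine Continuous.ext_on A.cyclic (a : K →L[ℂ] K).continuous continuous_const ?_
  rintro _ ⟨b, hb, rfl⟩
  exact key ⟨b, hb⟩

instance (A : TracialVonNeumannAlgebra K) :
    IsClosed ((A.alg.toStarSubalgebra : StarSubalgebra ℂ (K →L[ℂ] K)) : Set (K →L[ℂ] K)) := by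
  have h := A.alg.centralizer_centralizer
  rw [VonNeumannAlgebra.coe_toStarSubalgebra, ← h]
  exact Set.isClosed_centralizer _

/-- Automorphisms of `A` are contractive, hence isometric. -/
theorem norm_aut_le (A : TracialVonNeumannAlgebra K) (φ : A.Elem ≃⋆ₐ[ℂ] A.Elem) (a : A.Elem) :
    ‖((φ a : A.Elem) : K →L[ℂ] K)‖ ≤ ‖(a : K →L[ℂ] K)‖ :=
  NonUnitalStarAlgHom.norm_apply_le φ a

end TracialVonNeumannAlgebra

/-! ### Crossed products -/

section CrossedProduct

variable {K : Type u} [NormedAddCommGroup K] [InnerProductSpace ℂ K] [CompleteSpace K]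
variable {Γ : Type v} [Group Γ]

/-- The Hilbert space `ℓ²(Γ, K) = ℓ²(Γ) ⊗ K`. -/
abbrev L2 (Γ : Type v) (K : Type u) [NormedAddCommGroup K] [InnerProductSpace ℂ K] :
    Type (max u v) :=
  lp (fun _ : Γ => K) 2

/-- The unitary `λ_g ⊗ 1` on `ℓ²(Γ, K)`, that is, `(λ_g ξ)(h) = ξ(g⁻¹ h)`. -/
def leftTranslation (K : Type u) [NormedAddCommGroup K] [InnerProductSpace ℂ K] (g : Γ) :
    L2 Γ K →L[ℂ] L2 Γ K :=
  LinearIsometry.toContinuousLinearMap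
    { toFun := fun ξ => ⟨fun h => ξ (g⁻¹ * h), by
        have h2 : 0 < (2 : ℝ≥0∞).toReal := by norm_num
        exact (memℓp_gen_iff h2).2 (((memℓp_gen_iff h2).1 (lp.memℓp ξ)).comp_injective
          (mul_right_injective g⁻¹))⟩
      map_add' := fun _ _ => rfl
      map_smul' := fun _ _ => rfl
      norm_map' := fun ξ => by
        have h2 : 0 < (2 : ℝ≥0∞).toReal := by norm_num
        rw [lp.norm_eq_tsum_rpow h2, lp.norm_eq_tsum_rpow h2]
        congr 1
        exact (Equiv.mulLeft g⁻¹).tsum_eq (fun h => ‖ξ h‖ ^ (2 : ℝ≥0∞).toReal) }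

@[simp]
theorem leftTranslation_apply {V : Type u} [NormedAddCommGroup V] [InnerProductSpace ℂ V]
    (g : Γ) (ξ : L2 Γ V) (h : Γ) : leftTranslation V g ξ h = ξ (g⁻¹ * h) := rfl

/-- The representation `π` of `A` on `ℓ²(Γ, L²(A))`: `(π(a) ξ)(h) = σ_h⁻¹(a) ξ(h)`. -/
def crossedRep (A : TracialVonNeumannAlgebra K) (σ : Γ →* (A.Elem ≃⋆ₐ[ℂ] A.Elem)) (a : A.Elem) :
    L2 Γ K →L[ℂ] L2 Γ K :=
  lp.mapCLM 2 (fun h => (((σ h)⁻¹ a : A.Elem) : K →L[ℂ] K)) (norm_nonneg (a : K →L[ℂ] K))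
    (fun h => A.norm_aut_le (σ h)⁻¹ a)

@[simp]
theorem crossedRep_apply (A : TracialVonNeumannAlgebra K) (σ : Γ →* (A.Elem ≃⋆ₐ[ℂ] A.Elem))
    (a : A.Elem) (ξ : L2 Γ K) (h : Γ) :
    crossedRep A σ a ξ h = (((σ h)⁻¹ a : A.Elem) : K →L[ℂ] K) (ξ h) := rfl

/-- For a subgroup `L` of `Γ`, the crossed product `L ⋉ A`, realised inside `B(ℓ²(Γ, L²(A)))` as the
von Neumann algebra generated by `π(A)` and the unitaries `λ_g ⊗ 1`, `g ∈ L`. The full crossed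
product `Γ ⋉ A` is the case `L = ⊤`. -/
def crossedProduct (A : TracialVonNeumannAlgebra K) (σ : Γ →* (A.Elem ≃⋆ₐ[ℂ] A.Elem))
    (L : Subgroup Γ) : VonNeumannAlgebra (L2 Γ K) :=
  generatedVonNeumannAlgebra (Set.range (crossedRep A σ) ∪ leftTranslation K '' (L : Set Γ))

/-- `N` is invariant under the conjugation action of `Γ`. -/
def IsConjInvariant (N : VonNeumannAlgebra (L2 Γ K)) : Prop :=
  ∀ g : Γ, ∀ x ∈ N, leftTranslation K g * x * star (leftTranslation K g) ∈ N

/-- `N` is an amenable `Γ`-invariant von Neumann subalgebra of `Γ ⋉ A`. -/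
structure IsInvariantAmenableSubalgebra (A : TracialVonNeumannAlgebra K)
    (σ : Γ →* (A.Elem ≃⋆ₐ[ℂ] A.Elem)) (N : VonNeumannAlgebra (L2 Γ K)) : Prop where
  le_crossedProduct : N ≤ crossedProduct A σ ⊤
  invariant : IsConjInvariant N
  amenable : N.IsAmenable

end CrossedProduct

end

/-!
# Amenable invariant subalgebras of crossed products

Write `M = Γ ⋉ A`, with its trace given by the vector `Ω = δ_e ⊗ 1̂`, and let `N ⊆ M` be amenable
and `Γ`-invariant. The proof looks at `N`-central states on `B(ℓ²(Γ, L²(A)))` and at the way in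
which `Γ` moves them by conjugation.

*Central states.* Amenability of `N` gives an `N`-central state that restricts to the trace on `M`
(`exists_hypertrace`). Composing `⟪Ω, · Ω⟫` with an expectation onto `N` is not enough, since that
expectation need not preserve the trace of `M`; the operators are first transported to a multiple
of the closure of `N Ω`, where the compression of `m ∈ M` is the trace preserving expectation of
`m` onto `N`.

*An extreme idempotent.* The set of these central states is convex, weak-* compact and, because
`N` is invariant, stable under averaging over `Γ`. Averages are taken against means on `Γ`: a state
`ψ` restricts to `ℓ^∞(Γ)`, and `average ψ χ` sends `T` to the value of `ψ` on the orbit function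
`h ↦ χ(λ_h* T λ_h)`. As in the Ellis–Furstenberg theory of minimal actions, an extreme point `ε` of
a minimal convex compact average-stable subset satisfies `average ε ε = ε`
(`average_eq_self_of_mem_extremePoints`), and extremality forces the orbit functions `f_T` of `ε`
to be in the multiplicative domain of `ε`, with `ε(f_T) = ε(T)`
(`IsExtremeIdempotent.apply_mul_mulOp`).

*Vanishing of Fourier coefficients.* Let `x ∈ N` and `a ∈ A`. As `f_T` commutes with `π(a)` and
`λ_g*` translates it, centrality gives
`τ(x λ_g* π(a)) ε(T) = ε(x λ_g* π(a) f_T) = τ(x λ_g* π(a)) ε(λ_g* T λ_g)` for self-adjoint `T`.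
So if `g` moves `ε`, the Fourier coefficient of `x` at `g` is zero (`inner_crossedVac_eq_zero`). By
invariance of `N` the same holds for all `g` that have a conjugate moving `ε`, that is, for all `g`
outside the normal core of the stabilizer of `ε`. This core fixes the mean that `ε` induces on
`ℓ^∞(Γ)`, hence it is an amenable normal subgroup and lies in `Rad(Γ)`.

*Recovering membership.* An element of `M` with Fourier coefficients supported on a subgroup `L`
lies in `L ⋉ A`, since entry by entry it commutes with the commutant of `L ⋉ A`
(`mem_crossedProduct_of_entry_eq_zero`).

For trivial radical, `Rad(Γ) ⋉ A` is `π(A)`, which is itself invariant and amenable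
(`coe_crossedProduct_bot`, `isAmenable_crossedProduct_bot`), so it is maximal.
-/

noncomputable section

/-! ### States on the algebra of bounded operators -/

section States

open scoped ComplexOrder

variable {H : Type u} [NormedAddCommGroup H] [InnerProductSpace ℂ H]

/-- A state on `B(H)`, encoded as a bare function so that the state space can be topologised as a
subset of the product `B(H) → ℂ`, which is the weak-* topology. -/
structure IsState (φ : (H →L[ℂ] H) → ℂ) : Prop where
  map_add : ∀ S T, φ (S + T) = φ S + φ T
  map_smul : ∀ (c : ℂ) T, φ (c • T) = c * φ T
  map_nonneg : ∀ T : H →L[ℂ] H, T.IsPositive → 0 ≤ φ T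
  map_one : φ 1 = 1

theorem isState_vector {ξ : H} (hξ : ‖ξ‖ = 1) : IsState (fun T : H →L[ℂ] H => ⟪ξ, T ξ⟫_ℂ) where
  map_add S T := by simp
  map_smul c T := by simp
  map_nonneg T hT := hT.inner_nonneg_right ξ
  map_one := by simp [inner_self_eq_norm_sq_to_K, hξ]

namespace IsState

variable {φ : (H →L[ℂ] H) → ℂ}

theorem map_neg (hφ : IsState φ) (T) : φ (-T) = -φ T := by
  simpa using hφ.map_smul (-1) T

theorem map_sub (hφ : IsState φ) (S T) : φ (S - T) = φ S - φ T := by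
  rw [sub_eq_add_neg, hφ.map_add, hφ.map_neg, sub_eq_add_neg]

variable [CompleteSpace H]

/-- A state as a positive linear functional, which gives access to its GNS inner product. -/
def toPositive (hφ : IsState φ) : (H →L[ℂ] H) →ₚ[ℂ] ℂ :=
  PositiveLinearMap.mk₀
    { toFun := φ, map_add' := hφ.map_add, map_smul' := fun c T => by simp [hφ.map_smul] }
    (fun T hT => hφ.map_nonneg T ((ContinuousLinearMap.nonneg_iff_isPositive T).1 hT))

theorem toPositive_apply (hφ : IsState φ) (T) : hφ.toPositive T = φ T := rfl

theorem star_mul_self_nonneg (hφ : IsState φ) (T) : 0 ≤ φ (star T * T) :=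
  hφ.map_nonneg _ ((ContinuousLinearMap.nonneg_iff_isPositive _).1 (_root_.star_mul_self_nonneg T))

theorem map_star (hφ : IsState φ) (T) : φ (star T) = star (φ T) := by
  have h := inner_conj_symm (𝕜 := ℂ) (hφ.toPositive.toPreGNS T) (hφ.toPositive.toPreGNS 1)
  simp only [PositiveLinearMap.preGNS_inner_def, PositiveLinearMap.ofPreGNS_toPreGNS,
    toPositive_apply, mul_one, star_one, one_mul] at h
  rw [← h]
  rfl

theorem cauchy_schwarz (hφ : IsState φ) (S T) :
    ‖φ (star S * T)‖ ^ 2 ≤ (φ (star S * S)).re * (φ (star T * T)).re := by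
  have h := norm_inner_le_norm (𝕜 := ℂ) (hφ.toPositive.toPreGNS S) (hφ.toPositive.toPreGNS T)
  rw [PositiveLinearMap.preGNS_norm_def, PositiveLinearMap.preGNS_norm_def,
    PositiveLinearMap.preGNS_inner_def] at h
  simp only [PositiveLinearMap.ofPreGNS_toPreGNS, toPositive_apply] at h
  have h1 := (Complex.nonneg_iff.1 (hφ.star_mul_self_nonneg S)).1
  have h2 := (Complex.nonneg_iff.1 (hφ.star_mul_self_nonneg T)).1
  calc _ ≤ (√(φ (star S * S)).re * √(φ (star T * T)).re) ^ 2 := by gcongr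
    _ = _ := by rw [mul_pow, Real.sq_sqrt h1, Real.sq_sqrt h2]

theorem norm_le (hφ : IsState φ) (T) : ‖φ T‖ ≤ ‖T‖ := by
  have h := hφ.cauchy_schwarz 1 T
  simp only [star_one, one_mul, hφ.map_one, Complex.one_re] at h
  have h1 : (0 : H →L[ℂ] H) ≤ algebraMap ℂ (H →L[ℂ] H) ((‖T‖ : ℂ) ^ 2) - star T * T := by
    have := CStarAlgebra.star_mul_le_algebraMap_norm_sq (a := T)
    rw [sub_nonneg]
    convert! this
    simp [Algebra.algebraMap_eq_smul_one]
    norm_cast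
  have h2 := hφ.map_nonneg _ ((ContinuousLinearMap.nonneg_iff_isPositive _).1 h1)
  rw [hφ.map_sub, Algebra.algebraMap_eq_smul_one, hφ.map_smul, hφ.map_one, mul_one,
    Complex.nonneg_iff, Complex.sub_re, ← Complex.ofReal_pow, Complex.ofReal_re] at h2
  exact le_of_sq_le_sq (h.trans (by linarith [h2.1])) (norm_nonneg _)

theorem map_star_mul_eq_zero (hφ : IsState φ) {D} (hD : φ (star D * D) = 0) (S) :
    φ (star S * D) = 0 := by
  have h := hφ.cauchy_schwarz S D
  rw [hD, Complex.zero_re, mul_zero] at h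
  have : ‖φ (star S * D)‖ = 0 := by nlinarith [norm_nonneg (φ (star S * D))]
  simpa using this

/-- The compression of a state by an operator `V` that it does not annihilate. -/
theorem compress (hφ : IsState φ) (V : H →L[ℂ] H) (hV : φ (star V * V) ≠ 0) :
    IsState (fun T => φ (star V * T * V) / φ (star V * V)) where
  map_add S T := by rw [mul_add, add_mul, hφ.map_add, add_div]
  map_smul c T := by
    rw [mul_smul_comm, smul_mul_assoc, hφ.map_smul, mul_div_assoc]
  map_nonneg T hT := by
    refine div_nonneg (hφ.map_nonneg _ ?_) (hφ.star_mul_self_nonneg V)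
    rw [← ContinuousLinearMap.nonneg_iff_isPositive] at hT ⊢
    exact star_left_conjugate_nonneg hT V
  map_one := by rw [mul_one, div_self hV]

end IsState

variable [CompleteSpace H]

theorem isCompact_setOf_isState : IsCompact {φ : (H →L[ℂ] H) → ℂ | IsState φ} := by
  have hc : IsCompact (Set.pi Set.univ fun T : H →L[ℂ] H => Metric.closedBall (0 : ℂ) ‖T‖) :=
    isCompact_univ_pi fun T => isCompact_closedBall _ _
  refine hc.of_isClosed_subset ?_ ?_
  · have : {φ : (H →L[ℂ] H) → ℂ | IsState φ} =
        (⋂ S, ⋂ T, {φ | φ (S + T) = φ S + φ T}) ∩ ((⋂ c : ℂ, ⋂ T, {φ | φ (c • T) = c * φ T}) ∩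
        ((⋂ T : H →L[ℂ] H, ⋂ _ : T.IsPositive, {φ | 0 ≤ φ T}) ∩ {φ | φ 1 = 1})) := by
      ext φ
      simp only [Set.mem_inter_iff, Set.mem_iInter, Set.mem_ofPred_eq]
      exact ⟨fun h => ⟨h.1, h.2, h.3, h.4⟩, fun h => ⟨h.1, h.2.1, h.2.2.1, h.2.2.2⟩⟩
    rw [this]
    refine IsClosed.inter ?_ (IsClosed.inter ?_ (IsClosed.inter ?_ ?_))
    · exact isClosed_iInter fun S => isClosed_iInter fun T =>
        isClosed_eq (by fun_prop) (by fun_prop)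
    · exact isClosed_iInter fun S => isClosed_iInter fun T =>
        isClosed_eq (by fun_prop) (by fun_prop)
    · exact isClosed_iInter fun S => isClosed_iInter fun T =>
        isClosed_le (by fun_prop) (by fun_prop)
    · exact isClosed_eq (by fun_prop) (by fun_prop)
  · intro φ hφ T _
    simpa using hφ.norm_le T

end States

/-! ### Ampliations and isometries into multiples -/

section Ampliation

variable {H : Type u} [NormedAddCommGroup H] [InnerProductSpace ℂ H] {ι : Type v}

/-- The ampliation `T ⊗ 1` of an operator `T` on `H` to the Hilbert sum of copies of `H`. -/
def ampliation (ι : Type v) (T : H →L[ℂ] H) : L2 ι H →L[ℂ] L2 ι H :=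
  lp.mapCLM 2 (fun _ => T) (norm_nonneg T) (fun _ => le_rfl)

@[simp]
theorem ampliation_apply (T : H →L[ℂ] H) (ξ : L2 ι H) (i : ι) :
    ampliation ι T ξ i = T (ξ i) := rfl

theorem ampliation_single [DecidableEq ι] (T : H →L[ℂ] H) (i : ι) (ξ : H) :
    ampliation ι T (lp.single 2 i ξ) = lp.single 2 i (T ξ) := by
  ext j
  rw [ampliation_apply]
  rcases eq_or_ne j i with rfl | h
  · rw [lp.single_apply_self, lp.single_apply_self]
  · rw [lp.single_apply_ne _ _ _ h, lp.single_apply_ne _ _ _ h, map_zero]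

/-- Operators out of `ℓ²(ι, H)` agree if they agree on the vectors `δ_i ⊗ ξ`. -/
theorem L2.ext_single {F : Type*} [NormedAddCommGroup F] [NormedSpace ℂ F] [DecidableEq ι]
    {S T : L2 ι H →L[ℂ] F} (h : ∀ i (ξ : H), S (lp.single 2 i ξ) = T (lp.single 2 i ξ)) : S = T :=
  lp.ext_continuousLinearMap (by norm_num) fun i => ContinuousLinearMap.ext fun ξ => h i ξ

theorem L2.norm_single {V : Type u} [NormedAddCommGroup V] [InnerProductSpace ℂ V]
    [DecidableEq ι] (i : ι) (ξ : V) : ‖(lp.single 2 i ξ : L2 ι V)‖ = ‖ξ‖ := by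
  have h : (0 : ℝ≥0∞) < 2 := by simp
  exact lp.norm_single (E := fun _ : ι => V) h i ξ

theorem norm_single_comp_le [DecidableEq ι] (i : ι) (T : H →L[ℂ] H) :
    ‖lp.singleContinuousLinearMap ℂ (fun _ : ι => H) 2 i ∘L T‖ ≤ ‖T‖ := by
  refine ContinuousLinearMap.opNorm_le_bound _ (norm_nonneg T) fun ξ => ?_
  refine le_trans (le_of_eq ?_) (T.le_opNorm ξ)
  exact L2.norm_single i (T ξ)

theorem exists_hasSum_apply {F : Type*} [NormedAddCommGroup F] [NormedSpace ℂ F] [CompleteSpace F]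
    {s : ι → H →L[ℂ] F} {ε : ι → ℝ} (hε : Summable ε) (h : ∀ i, ‖s i‖ ≤ ε i) :
    ∃ C : H →L[ℂ] F, ∀ ξ, HasSum (fun i => s i ξ) (C ξ) :=
  ⟨∑' i, s i, fun ξ => (Summable.of_norm_bounded hε h).hasSum.mapL
    (ContinuousLinearMap.apply ℂ F ξ)⟩

variable [CompleteSpace H]

theorem inner_ampliation_left (T : H →L[ℂ] H) (ξ η : L2 ι H) :
    ⟪ampliation ι T ξ, η⟫_ℂ = ⟪ξ, ampliation ι (star T) η⟫_ℂ := by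
  rw [lp.inner_eq_tsum, lp.inner_eq_tsum]
  congr 1
  ext i
  rw [ampliation_apply, ampliation_apply, ContinuousLinearMap.star_eq_adjoint,
    ContinuousLinearMap.adjoint_inner_right]

theorem adjoint_ampliation (T : H →L[ℂ] H) :
    ContinuousLinearMap.adjoint (ampliation ι T) = ampliation ι (star T) := by
  symm
  rw [ContinuousLinearMap.eq_adjoint_iff]
  intro ξ η
  rw [inner_ampliation_left, star_star]

/-- After rescaling, countably many operators on `H` are the rows of a single bounded operator
from `H` to `ℓ²(ι, H)`. -/
theorem exists_column_operator [Countable ι] (B : ι → H →L[ℂ] H) :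
    ∃ (b : ι → ℝ) (C : H →L[ℂ] L2 ι H), (∀ i, 0 < b i) ∧ ∀ ξ i, C ξ i = (b i : ℂ) • B i ξ := by
  classical
  obtain ⟨ε, hε, c, hc, -⟩ := (Set.to_countable (Set.univ : Set ι)).exists_pos_hasSum_le one_pos
  have hεs : Summable (fun i : ι => ε i) := (Equiv.Set.univ ι).summable_iff.1 hc.summable
  obtain ⟨b, hb⟩ : ∃ b : ι → ℝ, ∀ i, b i = ε i / (1 + ‖B i‖) := ⟨_, fun i => rfl⟩
  have hb0 : ∀ i, 0 < b i := fun i => by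
    rw [hb]; exact div_pos (hε i) (by positivity)
  obtain ⟨s, hsi⟩ : ∃ s : ι → (H →L[ℂ] L2 ι H), ∀ i,
      s i = lp.singleContinuousLinearMap ℂ (fun _ : ι => H) 2 i ∘L ((b i : ℂ) • B i) :=
    ⟨_, fun i => rfl⟩
  have hsξ : ∀ i ξ, s i ξ = lp.single 2 i ((b i : ℂ) • B i ξ) := fun i ξ => by
    rw [hsi, ContinuousLinearMap.comp_apply, lp.singleContinuousLinearMap_apply]; rfl
  have hsn : ∀ i, ‖s i‖ ≤ ε i := fun i => by
    rw [hsi]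
    refine (norm_single_comp_le i _).trans ?_
    rw [norm_smul, Complex.norm_real, Real.norm_eq_abs, abs_of_pos (hb0 i), hb]
    have := norm_nonneg (B i)
    rw [div_mul_eq_mul_div, div_le_iff₀ (by positivity)]
    nlinarith [hε i]
  obtain ⟨C, hC⟩ := exists_hasSum_apply hεs hsn
  refine ⟨b, C, hb0, fun ξ j => ?_⟩
  have h1 : HasSum (fun i => s i ξ j) (C ξ j) :=
    (hC ξ).mapL (lp.evalCLM ℂ (fun _ : ι => H) 2 j)
  refine h1.unique ?_
  have h3 : (b j : ℂ) • B j ξ = s j ξ j := by rw [hsξ, lp.single_apply_self]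
  rw [h3]
  refine hasSum_single j fun i hi => ?_
  rw [hsξ, lp.single_apply_ne _ _ _ hi.symm]

/-- If `B ξ = (B_i ξ)_i` is injective, then the partial isometry in its polar decomposition is
an isometry into a multiple of `H` that inherits every intertwining relation satisfied by the
`B_i`. -/
theorem exists_isometry_intertwining [Countable ι] (B : ι → H →L[ℂ] H)
    (hB : ∀ ξ, (∀ i, B i ξ = 0) → ξ = 0) :
    ∃ W : H →L[ℂ] L2 ι H, ContinuousLinearMap.adjoint W ∘L W = 1 ∧
      (∀ x, (∀ i, B i * x = x * B i) → (∀ i, B i * star x = star x * B i) →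
        W ∘L x = ampliation ι x ∘L W) ∧
      (∀ y, (∀ i, y * B i = B i) → ampliation ι y ∘L W = W) := by
  obtain ⟨b, C, hb0, hCi⟩ := exists_column_operator B
  have hCinj : ∀ ξ, C ξ = 0 → ξ = 0 := by
    intro ξ h
    refine hB ξ fun i => ?_
    have h1 := hCi ξ i
    rw [h] at h1
    have h2 : (b i : ℂ) ≠ 0 := by exact_mod_cast (hb0 i).ne'
    exact (smul_eq_zero_iff_right h2).1 h1.symm
  set D : H →L[ℂ] H := ContinuousLinearMap.adjoint C ∘L C with hD
  have hD0 : 0 ≤ D := (ContinuousLinearMap.nonneg_iff_isPositive _).2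
    (ContinuousLinearMap.isPositive_adjoint_comp_self C)
  set P : H →L[ℂ] H := CFC.sqrt D with hP
  have hPP : P * P = D := CFC.sqrt_mul_sqrt_self D hD0
  have hPsa : ContinuousLinearMap.adjoint P = P :=
    (IsSelfAdjoint.of_nonneg (CFC.sqrt_nonneg D)).adjoint_eq
  have hin : ∀ ξ η, ⟪P ξ, P η⟫_ℂ = ⟪C ξ, C η⟫_ℂ := by
    intro ξ η
    rw [← ContinuousLinearMap.adjoint_inner_right, hPsa, ← mul_apply_eq_comp, hPP, hD,
      ContinuousLinearMap.comp_apply, ContinuousLinearMap.adjoint_inner_right]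
  have hnorm : ∀ ξ, ‖C ξ‖ = ‖P ξ‖ := by
    intro ξ
    rw [@norm_eq_sqrt_re_inner ℂ, @norm_eq_sqrt_re_inner ℂ, hin]
  have hdense : DenseRange P := by
    have h1 : P.rangeᗮ = ⊥ := by
      rw [ContinuousLinearMap.orthogonal_range, hPsa, eq_bot_iff]
      intro ξ hξ
      refine hCinj ξ ?_
      rw [← norm_eq_zero, hnorm, norm_eq_zero]
      exact hξ
    have h2 := (Submodule.topologicalClosure_eq_top_iff (K := P.range)).2 h1
    exact Submodule.dense_iff_topologicalClosure_eq_top.2 h2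
  let W : H →L[ℂ] L2 ι H := C.toLinearMap.extendOfNorm P.toLinearMap
  have hW : ∀ ξ, W (P ξ) = C ξ := fun ξ =>
    LinearMap.extendOfNorm_eq (f := C.toLinearMap) (e := P.toLinearMap) hdense
      ⟨1, fun x => by simpa using (hnorm x).le⟩ ξ
  have hext : ∀ {F : Type (max u v)} [NormedAddCommGroup F] [NormedSpace ℂ F] {S T : H →L[ℂ] F},
      (∀ ξ, S (P ξ) = T (P ξ)) → S = T := by
    intro F _ _ S T h
    refine ContinuousLinearMap.coeFn_injective
      (hdense.equalizer S.continuous T.continuous (funext h))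
  refine ⟨W, ?_, ?_, ?_⟩
  · refine ContinuousLinearMap.coeFn_injective
      (hdense.equalizer (ContinuousLinearMap.continuous _) (ContinuousLinearMap.continuous _)
      (funext fun ξ => ?_))
    refine hdense.eq_of_inner_right ℂ fun η => ?_
    rw [Function.comp_apply, ContinuousLinearMap.comp_apply,
      ContinuousLinearMap.adjoint_inner_right, hW, hW, ← hin]
    rfl
  · intro x h1 h2
    have key : ∀ z, (∀ i, B i * z = z * B i) → C ∘L z = ampliation ι z ∘L C := by
      intro z hz
      ext ξ i
      have := DFunLike.congr_fun (hz i) ξ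
      simp only [mul_apply_eq_comp] at this
      rw [ContinuousLinearMap.comp_apply, ContinuousLinearMap.comp_apply, ampliation_apply, hCi,
        hCi, this, map_smul]
    have k1 := key x h1
    have k2 : x ∘L ContinuousLinearMap.adjoint C =
        ContinuousLinearMap.adjoint C ∘L ampliation ι x := by
      have := congrArg ContinuousLinearMap.adjoint (key _ h2)
      rwa [ContinuousLinearMap.adjoint_comp, ContinuousLinearMap.adjoint_comp, adjoint_ampliation,
        star_star, ContinuousLinearMap.star_eq_adjoint, ContinuousLinearMap.adjoint_adjoint] at this
    have hcomm : Commute D x := by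
      change D ∘L x = x ∘L D
      rw [hD, ContinuousLinearMap.comp_assoc, k1, ← ContinuousLinearMap.comp_assoc, ← k2,
        ContinuousLinearMap.comp_assoc]
    have hPx : Commute P x := hcomm.cfcₙ_nnreal _
    refine hext fun ξ => ?_
    have h3 : x (P ξ) = P (x ξ) := (DFunLike.congr_fun hPx.eq ξ).symm
    rw [ContinuousLinearMap.comp_apply, ContinuousLinearMap.comp_apply, h3, hW, hW]
    exact DFunLike.congr_fun k1 ξ
  · intro y hy
    refine hext fun ξ => ?_
    rw [ContinuousLinearMap.comp_apply, hW]
    ext i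
    rw [ampliation_apply, hCi, map_smul]
    exact congrArg _ (DFunLike.congr_fun (hy i) ξ)

end Ampliation

/-! ### Hypertraces of amenable subalgebras -/

section Hypertrace

open scoped ComplexOrder

variable {H : Type u} [NormedAddCommGroup H] [InnerProductSpace ℂ H] [CompleteSpace H]

/-- The dense subspace `N Ω` of the cyclic subspace generated by `Ω`. -/
def orbitSubspace (N : VonNeumannAlgebra H) (Ω : H) : Submodule ℂ H :=
  (Subalgebra.toSubmodule N.toStarSubalgebra.toSubalgebra).map
    (ContinuousLinearMap.apply ℂ H Ω).toLinearMap

theorem forall_mem_closure_orbitSubspace {N : VonNeumannAlgebra H} {Ω : H} {p : H → Prop}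
    (hp : IsClosed {ξ | p ξ}) (h : ∀ n ∈ N, p (n Ω)) :
    ∀ ξ ∈ closure (orbitSubspace N Ω : Set H), p ξ := by
  intro ξ hξ
  refine closure_minimal (t := {ξ | p ξ}) ?_ hp hξ
  rintro _ ⟨n, hn, rfl⟩
  exact h n hn

/-- The orthogonal projection onto the closure of `N Ω`. -/
def cyclicProjection (N : VonNeumannAlgebra H) (Ω : H) : H →L[ℂ] H :=
  (orbitSubspace N Ω).topologicalClosure.starProjection

section cyclicProjection

variable (N : VonNeumannAlgebra H) (Ω : H)

theorem star_cyclicProjection : star (cyclicProjection N Ω) = cyclicProjection N Ω :=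
  isStarProjection_starProjection.isSelfAdjoint.star_eq

theorem cyclicProjection_mul_self :
    cyclicProjection N Ω * cyclicProjection N Ω = cyclicProjection N Ω :=
  isStarProjection_starProjection.isIdempotentElem.eq

theorem cyclicProjection_apply_apply (ξ : H) :
    cyclicProjection N Ω (cyclicProjection N Ω ξ) = cyclicProjection N Ω ξ :=
  DFunLike.congr_fun (cyclicProjection_mul_self N Ω) ξ

theorem inner_cyclicProjection_left (ξ η : H) :
    ⟪cyclicProjection N Ω ξ, η⟫_ℂ = ⟪ξ, cyclicProjection N Ω η⟫_ℂ :=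
  Submodule.inner_starProjection_left_eq_right _ _ _

theorem cyclicProjection_mem (ξ : H) :
    cyclicProjection N Ω ξ ∈ closure (orbitSubspace N Ω : Set H) :=
  Submodule.starProjection_apply_mem (orbitSubspace N Ω).topologicalClosure ξ

variable {N}

theorem cyclicProjection_apply_orbit {n : H →L[ℂ] H} (hn : n ∈ N) :
    cyclicProjection N Ω (n Ω) = n Ω :=
  Submodule.starProjection_eq_self_iff.2 (subset_closure ⟨n, hn, rfl⟩)

theorem cyclicProjection_apply_self : cyclicProjection N Ω Ω = Ω :=
  cyclicProjection_apply_orbit Ω (one_mem N)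

variable (N)

theorem cyclicProjection_mem_commutant : cyclicProjection N Ω ∈ N.commutant := by
  have hsp : IsStarProjection (cyclicProjection N Ω) := isStarProjection_starProjection
  refine (VonNeumannAlgebra.IsStarProjection.mem_iff hsp _).2 ?_
  intro y hy
  rw [VonNeumannAlgebra.commutant_commutant] at hy
  have hr : (cyclicProjection N Ω).range = (orbitSubspace N Ω).topologicalClosure :=
    Submodule.range_starProjection _
  rw [hr, Module.End.mem_invtSubmodule]
  exact forall_mem_closure_orbitSubspace
    ((isClosed_closure (s := (orbitSubspace N Ω : Set H))).preimage y.continuous)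
    fun n hn => subset_closure ⟨y * n, (mul_mem hy hn : y * n ∈ N), rfl⟩

theorem cyclicProjection_comm {n : H →L[ℂ] H} (hn : n ∈ N) (ξ : H) :
    cyclicProjection N Ω (n ξ) = n (cyclicProjection N Ω ξ) :=
  (DFunLike.congr_fun
    (VonNeumannAlgebra.mem_commutant_iff.1 (cyclicProjection_mem_commutant N Ω) n hn) ξ).symm

end cyclicProjection

theorem inner_star_left (T : H →L[ℂ] H) (ξ η : H) : ⟪(star T) ξ, η⟫_ℂ = ⟪ξ, T η⟫_ℂ := by
  rw [ContinuousLinearMap.star_eq_adjoint, ContinuousLinearMap.adjoint_inner_left]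

theorem inner_star_right (T : H →L[ℂ] H) (ξ η : H) : ⟪ξ, (star T) η⟫_ℂ = ⟪T ξ, η⟫_ℂ := by
  rw [ContinuousLinearMap.star_eq_adjoint, ContinuousLinearMap.adjoint_inner_right]

/-- `Ω` is a trace vector for `M`. -/
def IsTraceVector (M : VonNeumannAlgebra H) (Ω : H) : Prop :=
  ∀ a ∈ M, ∀ b ∈ M, ⟪Ω, (a * b) Ω⟫_ℂ = ⟪Ω, (b * a) Ω⟫_ℂ

section Trace

variable {N M : VonNeumannAlgebra H} {Ω : H}

theorem IsTraceVector.norm_star_apply (htr : IsTraceVector M Ω) {m : H →L[ℂ] H} (hm : m ∈ M) :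
    ‖(star m) Ω‖ = ‖m Ω‖ := by
  rw [@norm_eq_sqrt_re_inner ℂ, @norm_eq_sqrt_re_inner ℂ, inner_star_left, ← inner_star_right m]
  have := htr m hm (star m) (star_mem hm)
  simp only [mul_apply_eq_comp] at this
  rw [this]

/-- For a trace vector, the involution `m Ω ↦ m* Ω` is isometric and it commutes with the
projection onto the cyclic subspace of a subalgebra. -/
theorem norm_cyclicProjection_star (hNM : N ≤ M) (htr : IsTraceVector M Ω) {m : H →L[ℂ] H}
    (hm : m ∈ M) :
    ‖cyclicProjection N Ω ((star m) Ω)‖ ≤ ‖cyclicProjection N Ω (m Ω)‖ := by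
  set e := cyclicProjection N Ω
  have h1 : ∀ v ∈ closure (orbitSubspace N Ω : Set H),
      ‖⟪v, (star m) Ω⟫_ℂ‖ ≤ ‖e (m Ω)‖ * ‖v‖ := by
    refine forall_mem_closure_orbitSubspace (isClosed_le (by fun_prop) (by fun_prop))
      fun n hn => ?_
    have h2 : ⟪n Ω, (star m) Ω⟫_ℂ = ⟪e (m Ω), (star n) Ω⟫_ℂ := by
      rw [inner_cyclicProjection_left, cyclicProjection_apply_orbit Ω (star_mem hn),
        ← inner_star_right n, ← inner_star_right m]
      have := htr _ (star_mem (hNM hn)) _ (star_mem hm)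
      simpa only [mul_apply_eq_comp] using this
    rw [h2]
    refine (norm_inner_le_norm _ _).trans_eq ?_
    rw [htr.norm_star_apply (hNM hn)]
  have h3 := h1 _ (cyclicProjection_mem N Ω ((star m) Ω))
  have h4 : ⟪cyclicProjection N Ω ((star m) Ω), (star m) Ω⟫_ℂ =
      ⟪cyclicProjection N Ω ((star m) Ω), cyclicProjection N Ω ((star m) Ω)⟫_ℂ := by
    rw [← inner_cyclicProjection_left, cyclicProjection_apply_apply]
  have h6 : ‖e ((star m) Ω)‖ * ‖e ((star m) Ω)‖ ≤ ‖e (m Ω)‖ * ‖e ((star m) Ω)‖ := by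
    rw [h4] at h3
    rw [← inner_self_eq_norm_mul_norm (𝕜 := ℂ)]
    exact (RCLike.re_le_norm _).trans h3
  by_contra! h7
  nlinarith [norm_nonneg (e (m Ω))]

theorem inner_commutant_cyclicProjection (hNM : N ≤ M) (htr : IsTraceVector M Ω)
    {m S : H →L[ℂ] H} (hm : m ∈ M) (hS : S ∈ N.commutant) :
    ⟪Ω, S (cyclicProjection N Ω (m Ω))⟫_ℂ = ⟪Ω, m (cyclicProjection N Ω (S Ω))⟫_ℂ := by
  set e := cyclicProjection N Ω with he
  rw [← sub_eq_zero, ← norm_le_zero_iff]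
  -- The two sides agree for `m ∈ N`, and both are continuous in `e m Ω`.
  have key : ∀ n ∈ N, ‖⟪Ω, S (e (m Ω))⟫_ℂ - ⟪Ω, m (e (S Ω))⟫_ℂ‖ ≤
      (‖(star S) Ω‖ + ‖S Ω‖) * ‖e (m Ω) - n Ω‖ := by
    intro n hn
    have h1 : ⟪Ω, S (n Ω)⟫_ℂ = ⟪Ω, n (e (S Ω))⟫_ℂ := by
      have := DFunLike.congr_fun (VonNeumannAlgebra.mem_commutant_iff.1 hS n hn) Ω
      rw [mul_apply_eq_comp, mul_apply_eq_comp] at this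
      rw [← this, ← cyclicProjection_comm N Ω hn, ← inner_cyclicProjection_left,
        cyclicProjection_apply_self]
    have h2 : ⟪Ω, S (e (m Ω))⟫_ℂ - ⟪Ω, m (e (S Ω))⟫_ℂ =
        ⟪(star S) Ω, e (m Ω) - n Ω⟫_ℂ - ⟪e ((star (m - n)) Ω), S Ω⟫_ℂ := by
      rw [inner_cyclicProjection_left, inner_star_left, inner_star_left, map_sub, inner_sub_right,
        h1, sub_apply, inner_sub_right]
      ring
    have h3 : e (m Ω) - n Ω = e ((m - n) Ω) := by
      rw [sub_apply, map_sub, he, cyclicProjection_apply_orbit Ω hn]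
    have h4 : ‖e ((star (m - n)) Ω)‖ ≤ ‖e (m Ω) - n Ω‖ := by
      rw [h3]
      exact norm_cyclicProjection_star hNM htr (sub_mem hm (hNM hn))
    rw [h2]
    calc _ ≤ ‖⟪(star S) Ω, e (m Ω) - n Ω⟫_ℂ‖ + ‖⟪e ((star (m - n)) Ω), S Ω⟫_ℂ‖ := norm_sub_le _ _
      _ ≤ ‖(star S) Ω‖ * ‖e (m Ω) - n Ω‖ + ‖e ((star (m - n)) Ω)‖ * ‖S Ω‖ :=
          add_le_add (norm_inner_le_norm _ _) (norm_inner_le_norm _ _)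
      _ ≤ ‖(star S) Ω‖ * ‖e (m Ω) - n Ω‖ + ‖e (m Ω) - n Ω‖ * ‖S Ω‖ := by gcongr
      _ = _ := by ring
  have h5 : ∀ v ∈ closure (orbitSubspace N Ω : Set H),
      ‖⟪Ω, S (e (m Ω))⟫_ℂ - ⟪Ω, m (e (S Ω))⟫_ℂ‖ ≤ (‖(star S) Ω‖ + ‖S Ω‖) * ‖e (m Ω) - v‖ := by
    exact forall_mem_closure_orbitSubspace (isClosed_le (by fun_prop) (by fun_prop)) key
  have h6 := h5 _ (cyclicProjection_mem N Ω (m Ω))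
  rwa [← he, sub_self, norm_zero, mul_zero] at h6

/-- The compressions of `M` and of `N'` to the cyclic subspace of `N` commute: the compression of
`m ∈ M` is the trace preserving conditional expectation of `m` onto `N`. -/
theorem compression_comm (hNM : N ≤ M) (htr : IsTraceVector M Ω)
    {m S : H →L[ℂ] H} (hm : m ∈ M) (hS : S ∈ N.commutant) :
    letI e := cyclicProjection N Ω
    e * S * (e * m * e) = e * m * e * (S * e) := by
  set e := cyclicProjection N Ω with he
  have h1 : ∀ v ∈ closure (orbitSubspace N Ω : Set H), ∀ w ∈ closure (orbitSubspace N Ω : Set H),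
      ⟪v, S (e (m w))⟫_ℂ = ⟪v, m (e (S w))⟫_ℂ := by
    intro v hv
    refine forall_mem_closure_orbitSubspace (isClosed_eq (by fun_prop) (by fun_prop))
      fun y hy => ?_
    revert v
    refine forall_mem_closure_orbitSubspace (isClosed_eq (by fun_prop) (by fun_prop))
      fun z hz => ?_
    have hc : ∀ n ∈ N, ∀ ξ, n (S ξ) = S (n ξ) := fun n hn ξ =>
      DFunLike.congr_fun (VonNeumannAlgebra.mem_commutant_iff.1 hS n hn) ξ
    have h2 := inner_commutant_cyclicProjection hNM htr
      (mul_mem (mul_mem (star_mem (hNM hz)) hm) (hNM hy)) hS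
    simp only [mul_apply_eq_comp] at h2
    rw [← he, cyclicProjection_comm N Ω (star_mem hz), ← hc _ (star_mem hz), inner_star_right,
      inner_star_right, ← cyclicProjection_comm N Ω hy, hc _ hy] at h2
    exact h2
  ext ξ
  refine ext_inner_left ℂ fun η => ?_
  simp only [mul_apply_eq_comp]
  rw [← inner_cyclicProjection_left, ← inner_cyclicProjection_left]
  exact h1 _ (cyclicProjection_mem N Ω η) _ (cyclicProjection_mem N Ω ξ)

end Trace

/-- A vector `Ω` that is cyclic for the commutant of `M` (expressed here through countably many
vectors `S_i Ω` with `S_i ∈ M'`) allows one to embed `H`, as an `N`-module, into a multiple of the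
closure of `N Ω`. -/
theorem exists_isometry_cyclicProjection {N : VonNeumannAlgebra H} {Ω : H}
    {ι : Type v} [Countable ι] (S : ι → H →L[ℂ] H) (hS : ∀ i, S i ∈ N.commutant)
    (htot : ∀ ξ, (∀ i, ⟪S i Ω, ξ⟫_ℂ = 0) → ξ = 0) :
    ∃ W : H →L[ℂ] L2 ι H, ContinuousLinearMap.adjoint W ∘L W = 1 ∧
      (∀ x ∈ N, W ∘L x = ampliation ι x ∘L W) ∧
      ampliation ι (cyclicProjection N Ω) ∘L W = W := by
  obtain ⟨W, h1, h2, h3⟩ := exists_isometry_intertwining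
    (fun i => cyclicProjection N Ω * star (S i)) (fun ξ hξ => htot ξ fun i => by
      have h := congrArg (fun v => ⟪Ω, v⟫_ℂ) (hξ i)
      simp only [mul_apply_eq_comp, inner_zero_right] at h
      rwa [← inner_cyclicProjection_left, cyclicProjection_apply_self, inner_star_right] at h)
  have hmem : ∀ i, cyclicProjection N Ω * star (S i) ∈ N.commutant := fun i =>
    mul_mem (cyclicProjection_mem_commutant N Ω) (star_mem (hS i))
  have hc : ∀ x ∈ N, ∀ i, cyclicProjection N Ω * star (S i) * x =
      x * (cyclicProjection N Ω * star (S i)) := fun x hx i =>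
    (VonNeumannAlgebra.mem_commutant_iff.1 (hmem i) x hx).symm
  refine ⟨W, h1, fun x hx => h2 x (hc x hx) (hc _ (star_mem hx)), h3 _ fun i => ?_⟩
  rw [← mul_assoc, cyclicProjection_mul_self]

theorem isPositive_ampliation {ι : Type v} {T : H →L[ℂ] H} (hT : T.IsPositive) :
    (ampliation ι T).IsPositive := by
  rw [ContinuousLinearMap.isPositive_iff'] at hT ⊢
  refine ⟨?_, fun ξ => ?_⟩
  · rw [IsSelfAdjoint, ContinuousLinearMap.star_eq_adjoint, adjoint_ampliation, hT.1.star_eq]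
  · rw [lp.inner_eq_tsum]
    exact tsum_nonneg fun i => hT.2 (ξ i)

/-- Compressing the ampliation of `m ∈ M` by an isometry as in
`exists_isometry_cyclicProjection` gives an element of `N` with the same trace as `m`. -/
theorem compress_ampliation_mem {N M : VonNeumannAlgebra H} {Ω : H} (hNM : N ≤ M)
    (htr : IsTraceVector M Ω) {ι : Type v} {W : H →L[ℂ] L2 ι H}
    (hW : ContinuousLinearMap.adjoint W ∘L W = 1)
    (hWx : ∀ x ∈ N, W ∘L x = ampliation ι x ∘L W)
    (hWe : ampliation ι (cyclicProjection N Ω) ∘L W = W) {m : H →L[ℂ] H} (hm : m ∈ M) :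
    ContinuousLinearMap.adjoint W ∘L ampliation ι m ∘L W ∈ N ∧
      ⟪Ω, (ContinuousLinearMap.adjoint W ∘L ampliation ι m ∘L W) Ω⟫_ℂ = ⟪Ω, m Ω⟫_ℂ := by
  classical
  set e := cyclicProjection N Ω with he
  have hee : e * e = e := cyclicProjection_mul_self N Ω
  have hes : star e = e := star_cyclicProjection N Ω
  have hemem : e ∈ N.commutant := cyclicProjection_mem_commutant N Ω
  obtain ⟨T, hT⟩ : ∃ T, T = e * m * e := ⟨_, rfl⟩
  have hWW : ∀ ξ, ContinuousLinearMap.adjoint W (W ξ) = ξ := fun ξ => DFunLike.congr_fun hW ξ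
  have hWe' : ∀ ξ, ampliation ι e (W ξ) = W ξ := fun ξ => DFunLike.congr_fun hWe ξ
  have hcomm : ∀ X ∈ N.commutant, e * X = X → X * e = X → ∀ ξ, X (T ξ) = T (X ξ) := by
    intro X hX h1 h2 ξ
    have := compression_comm hNM htr hm hX
    rw [← he, h1, h2, ← hT] at this
    exact DFunLike.congr_fun this ξ
  have hTm : ContinuousLinearMap.adjoint W ∘L ampliation ι m ∘L W =
      ContinuousLinearMap.adjoint W ∘L ampliation ι T ∘L W := by
    ext η
    refine ext_inner_left ℂ fun ξ => ?_
    simp only [ContinuousLinearMap.comp_apply, ContinuousLinearMap.adjoint_inner_right]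
    rw [← hWe' ξ, ← hWe' η, inner_ampliation_left, inner_ampliation_left, hes]
    congr 1
    ext i
    simp only [ampliation_apply, hT, mul_apply_eq_comp, he, cyclicProjection_apply_apply]
  -- The entries `w_i` of `W*` lie in `N'`, and the `w_i* S w_j` are supported on the range of `e`.
  obtain ⟨w, hw⟩ : ∃ w : ι → H →L[ℂ] H,
      ∀ i ξ, w i ξ = ContinuousLinearMap.adjoint W (lp.single 2 i ξ) :=
    ⟨fun i => ContinuousLinearMap.adjoint W ∘L
      lp.singleContinuousLinearMap ℂ (fun _ : ι => H) 2 i, fun i ξ => rfl⟩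
  have hw_inner : ∀ i ξ η, ⟪w i ξ, η⟫_ℂ = ⟪ξ, W η i⟫_ℂ := fun i ξ η => by
    rw [hw, ContinuousLinearMap.adjoint_inner_left, lp.inner_single_left]
  have hws : ∀ i ξ, (star (w i)) ξ = W ξ i := fun i ξ =>
    ext_inner_left ℂ fun η => by rw [inner_star_right, hw_inner]
  have hwmem : ∀ i, star (w i) ∈ N.commutant := fun i => by
    rw [VonNeumannAlgebra.mem_commutant_iff]
    intro x hx
    ext ξ
    rw [mul_apply_eq_comp, mul_apply_eq_comp, hws, hws, ← ContinuousLinearMap.comp_apply W,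
      hWx x hx]
    rfl
  have hew : ∀ i, e * star (w i) = star (w i) := fun i => by
    ext ξ
    rw [mul_apply_eq_comp, hws]
    exact congrArg (fun v : L2 ι H => v i) (hWe' ξ)
  have hwe : ∀ i, w i * e = w i := fun i => by
    have := congrArg star (hew i)
    rwa [star_mul, star_star, hes] at this
  have hQ : ∀ S ∈ N.commutant, ∀ ζ, W (S (ContinuousLinearMap.adjoint W (ampliation ι T ζ))) =
      ampliation ι T (W (S (ContinuousLinearMap.adjoint W ζ))) := by
    intro S hS ζ
    have : W ∘L S ∘L ContinuousLinearMap.adjoint W ∘L ampliation ι T =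
        ampliation ι T ∘L W ∘L S ∘L ContinuousLinearMap.adjoint W := by
      refine L2.ext_single fun i ξ => ?_
      simp only [ContinuousLinearMap.comp_apply, ampliation_single, ← hw]
      ext j
      rw [ampliation_apply, ← hws, ← hws]
      refine hcomm (star (w j) * S * w i) (mul_mem (mul_mem (hwmem j) hS) ?_) ?_ ?_ ξ
      · simpa using star_mem (hwmem i)
      · rw [← mul_assoc, ← mul_assoc, hew]
      · rw [mul_assoc, hwe]
    exact DFunLike.congr_fun this ζ
  rw [hTm]
  constructor
  · rw [← N.commutant_commutant, VonNeumannAlgebra.mem_commutant_iff]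
    intro S hS
    ext ξ
    simp only [mul_apply_eq_comp, ContinuousLinearMap.comp_apply]
    have h := congrArg (ContinuousLinearMap.adjoint W) (hQ S hS (W ξ))
    rwa [hWW, hWW] at h
  · have hTΩ : ampliation ι T (W Ω) = W (T Ω) := by
      ext i
      rw [ampliation_apply, ← hws, ← hws]
      have h1 := hcomm (star (w i) * e) (mul_mem (hwmem i) hemem)
        (by rw [← mul_assoc, hew]) (by rw [mul_assoc, hee]) Ω
      have h2 : e (T Ω) = T Ω := by
        simp only [hT, mul_apply_eq_comp, he, cyclicProjection_apply_apply]
      rw [mul_apply_eq_comp, mul_apply_eq_comp, h2, he, cyclicProjection_apply_self] at h1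
      exact h1.symm
    rw [ContinuousLinearMap.comp_apply, ContinuousLinearMap.comp_apply, hTΩ, hWW]
    simp only [hT, mul_apply_eq_comp, he, cyclicProjection_apply_self]
    rw [← inner_cyclicProjection_left, cyclicProjection_apply_self]

/-- Let `Ω` be a trace vector for `M ⊇ N` that is cyclic for `M'`, and let `N` be amenable. Then
`B(H)` carries an `N`-central state that restricts to the trace on `M`. Transporting operators on
the closure of `N Ω` to `H` by the isometry of `exists_isometry_cyclicProjection` turns the
expectation onto `N` into one which on `M` is the trace preserving one. -/
theorem exists_hypertrace {N M : VonNeumannAlgebra H} {Ω : H} (hNM : N ≤ M) (hΩ : ‖Ω‖ = 1)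
    (htr : IsTraceVector M Ω) (hN : N.IsAmenable) {ι : Type v} [Countable ι] (S : ι → H →L[ℂ] H)
    (hS : ∀ i, S i ∈ M.commutant) (htot : ∀ ξ, (∀ i, ⟪S i Ω, ξ⟫_ℂ = 0) → ξ = 0) :
    ∃ φ : (H →L[ℂ] H) → ℂ, IsState φ ∧ (∀ x ∈ N, ∀ T, φ (x * T) = φ (T * x)) ∧
      ∀ m ∈ M, φ m = ⟪Ω, m Ω⟫_ℂ := by
  classical
  obtain ⟨E, hE⟩ := hN
  obtain ⟨W, hW, hWx, hWe⟩ := exists_isometry_cyclicProjection (N := N) (Ω := Ω) S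
    (fun i => VonNeumannAlgebra.mem_commutant_iff.2 fun n hn =>
      VonNeumannAlgebra.mem_commutant_iff.1 (hS i) n (hNM hn)) htot
  have hWW : ∀ ξ η, ⟪W ξ, W η⟫_ℂ = ⟪ξ, η⟫_ℂ := fun ξ η => by
    rw [← ContinuousLinearMap.adjoint_inner_right]
    exact congrArg _ (DFunLike.congr_fun hW η)
  have hWx' : ∀ x ∈ N, ∀ ξ, W (x ξ) = ampliation ι x (W ξ) := fun x hx ξ =>
    DFunLike.congr_fun (hWx x hx) ξ
  obtain ⟨Θ, hΘd⟩ : ∃ Θ : (H →L[ℂ] H) → (H →L[ℂ] H), ∀ T,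
      Θ T = ContinuousLinearMap.adjoint W ∘L ampliation ι T ∘L W := ⟨_, fun T => rfl⟩
  have hΘ : ∀ T ξ η, ⟪ξ, Θ T η⟫_ℂ = ⟪W ξ, ampliation ι T (W η)⟫_ℂ := fun T ξ η => by
    rw [hΘd, ContinuousLinearMap.comp_apply, ContinuousLinearMap.adjoint_inner_right,
      ContinuousLinearMap.comp_apply]
  have hext : ∀ {S T : H →L[ℂ] H}, (∀ ξ η, ⟪ξ, S η⟫_ℂ = ⟪ξ, T η⟫_ℂ) → S = T := fun h =>
    ContinuousLinearMap.ext fun η => ext_inner_left ℂ fun ξ => h ξ η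
  have hΘ_add : ∀ S T, Θ (S + T) = Θ S + Θ T := fun S T => hext fun ξ η => by
    rw [add_apply, inner_add_right, hΘ, hΘ, hΘ, ← inner_add_right]; rfl
  have hΘ_smul : ∀ (c : ℂ) T, Θ (c • T) = c • Θ T := fun c T => hext fun ξ η => by
    rw [smul_apply, inner_smul_right, hΘ, hΘ, ← inner_smul_right]; rfl
  have hΘ_one : Θ 1 = 1 := hext fun ξ η => by
    rw [hΘ]; exact hWW ξ η
  have hΘ_left : ∀ x ∈ N, ∀ T, Θ (x * T) = x * Θ T := fun x hx T => hext fun ξ η => by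
    rw [hΘ, mul_apply_eq_comp x, ← inner_star_left x, hΘ, hWx' _ (star_mem hx),
      inner_ampliation_left, star_star]
    rfl
  have hΘ_right : ∀ x ∈ N, ∀ T, Θ (T * x) = Θ T * x := fun x hx T => hext fun ξ η => by
    rw [hΘ, mul_apply_eq_comp (Θ T), hΘ, hWx' _ hx]
    rfl
  have hΘ_pos : ∀ T : H →L[ℂ] H, T.IsPositive → (Θ T).IsPositive := fun T hT => by
    rw [hΘd]
    exact (isPositive_ampliation hT).adjoint_conj W
  have hE_one : E 1 = 1 := hE.map_of_mem 1 (one_mem N)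
  have hE_left : ∀ x ∈ N, ∀ T, E (x * T) = x * E T := fun x hx T => by
    simpa using hE.map_bimodule x hx 1 (one_mem N) T
  have hE_right : ∀ x ∈ N, ∀ T, E (T * x) = E T * x := fun x hx T => by
    simpa using hE.map_bimodule 1 (one_mem N) x hx T
  refine ⟨fun T => ⟪Ω, E (Θ T) Ω⟫_ℂ, ⟨?_, ?_, ?_, ?_⟩, ?_, ?_⟩
  · intro S T
    rw [hΘ_add, map_add, add_apply, inner_add_right]
  · intro c T
    rw [hΘ_smul, map_smul, smul_apply, inner_smul_right]
  · exact fun T hT => (isState_vector hΩ).map_nonneg _ (hE.map_nonneg _ (hΘ_pos T hT))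
  · rw [hΘ_one, hE_one]
    exact (isState_vector hΩ).map_one
  · intro x hx T
    change ⟪Ω, E (Θ (x * T)) Ω⟫_ℂ = ⟪Ω, E (Θ (T * x)) Ω⟫_ℂ
    rw [hΘ_left x hx, hΘ_right x hx, hE_left x hx, hE_right x hx]
    exact htr _ (hNM hx) _ (hNM (hE.map_mem _))
  · intro m hm
    obtain ⟨h1, h2⟩ := compress_ampliation_mem hNM htr hW hWx hWe hm
    rw [← hΘd] at h1 h2
    change ⟪Ω, E (Θ m) Ω⟫_ℂ = _
    rw [hE.map_of_mem _ h1, h2]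

end Hypertrace

/-! ### Translations, the standard form and the commutant of the crossed product -/

section Translations

variable {K : Type u} [NormedAddCommGroup K] [InnerProductSpace ℂ K]
variable {Γ : Type v} [Group Γ]

theorem leftTranslation_single [DecidableEq Γ] (g k : Γ) (ξ : K) :
    leftTranslation K g (lp.single 2 k ξ) = lp.single 2 (g * k) ξ := by
  ext h
  rw [leftTranslation_apply]
  rcases eq_or_ne h (g * k) with rfl | hne
  · rw [inv_mul_cancel_left, lp.single_apply_self, lp.single_apply_self]
  · rw [lp.single_apply_ne _ _ _ hne, lp.single_apply_ne]
    rintro h'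
    exact hne (by rw [← h', mul_inv_cancel_left])

theorem leftTranslation_mul (g h : Γ) :
    leftTranslation K (g * h) = leftTranslation K g * leftTranslation K h := by
  ext ξ k
  rw [mul_apply_eq_comp, leftTranslation_apply, leftTranslation_apply, leftTranslation_apply,
    mul_inv_rev, mul_assoc]

theorem leftTranslation_one : leftTranslation K (1 : Γ) = 1 := by
  ext ξ k
  rw [leftTranslation_apply, inv_one, one_mul]; rfl

theorem leftTranslation_mul_inv (g : Γ) :
    leftTranslation K g * leftTranslation K g⁻¹ = 1 := by
  rw [← leftTranslation_mul, mul_inv_cancel, leftTranslation_one]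

theorem leftTranslation_inv_mul (g : Γ) :
    leftTranslation K g⁻¹ * leftTranslation K g = 1 := by
  rw [← leftTranslation_mul, inv_mul_cancel, leftTranslation_one]

/-- The right translation `ξ ↦ ξ(· g)` on `ℓ²(Γ, K)`. -/
def rightTranslation (K : Type u) [NormedAddCommGroup K] [InnerProductSpace ℂ K] (g : Γ) :
    L2 Γ K →L[ℂ] L2 Γ K :=
  LinearIsometry.toContinuousLinearMap
    { toFun := fun ξ => ⟨fun h => ξ (h * g), by
        have h2 : 0 < (2 : ℝ≥0∞).toReal := by norm_num
        exact (memℓp_gen_iff h2).2 (((memℓp_gen_iff h2).1 (lp.memℓp ξ)).comp_injective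
          (mul_left_injective g))⟩
      map_add' := fun _ _ => rfl
      map_smul' := fun _ _ => rfl
      norm_map' := fun ξ => by
        have h2 : 0 < (2 : ℝ≥0∞).toReal := by norm_num
        rw [lp.norm_eq_tsum_rpow h2, lp.norm_eq_tsum_rpow h2]
        congr 1
        exact (Equiv.mulRight g).tsum_eq (fun h => ‖ξ h‖ ^ (2 : ℝ≥0∞).toReal) }

theorem rightTranslation_apply (g : Γ) (ξ : L2 Γ K) (h : Γ) :
    rightTranslation K g ξ h = ξ (h * g) := rfl

end Translations

section CrossedProductStructure

variable {K : Type u} [NormedAddCommGroup K] [InnerProductSpace ℂ K] [CompleteSpace K]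
variable {Γ : Type v} [Group Γ]

namespace TracialVonNeumannAlgebra

variable (A : TracialVonNeumannAlgebra K)

/-- The map `a ↦ â = a 1̂` from `A` to `L²(A)`. -/
def toL2 : A.Elem →ₗ[ℂ] K where
  toFun a := (a : K →L[ℂ] K) A.vac
  map_add' _ _ := rfl
  map_smul' _ _ := rfl

theorem toL2_one : A.toL2 1 = A.vac := rfl

theorem toL2_mul (a b : A.Elem) : A.toL2 (a * b) = (a : K →L[ℂ] K) (A.toL2 b) := rfl

theorem denseRange_toL2 : DenseRange A.toL2 := by
  refine A.cyclic.mono ?_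
  rintro _ ⟨a, ha, rfl⟩
  exact ⟨⟨a, ha⟩, rfl⟩

theorem inner_toL2 (a b : A.Elem) : ⟪A.toL2 a, A.toL2 b⟫_ℂ = A.trace (star a * b) :=
  (A.trace_star_mul a b).symm

variable {A} in
theorem ext_toL2 {F : Type*} [NormedAddCommGroup F] [NormedSpace ℂ F] {S T : K →L[ℂ] F}
    (h : ∀ a, S (A.toL2 a) = T (A.toL2 a)) : S = T :=
  ContinuousLinearMap.coeFn_injective
    (A.denseRange_toL2.equalizer S.continuous T.continuous (funext h))

theorem norm_toL2_star (a : A.Elem) : ‖A.toL2 (star a)‖ = ‖A.toL2 a‖ := by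
  rw [@norm_eq_sqrt_re_inner ℂ, @norm_eq_sqrt_re_inner ℂ, inner_toL2, inner_toL2, star_star,
    A.trace_mul_comm]

/-- Right multiplication by `b` on `L²(A)`. -/
def rightMul (b : A.Elem) : K →L[ℂ] K :=
  (A.toL2 ∘ₗ (LinearMap.mulRight ℂ b)).extendOfNorm A.toL2

theorem rightMul_toL2 (a b : A.Elem) : A.rightMul b (A.toL2 a) = A.toL2 (a * b) := by
  refine LinearMap.extendOfNorm_eq A.denseRange_toL2
    ⟨‖((star b : A.Elem) : K →L[ℂ] K)‖, fun a => ?_⟩ a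
  change ‖A.toL2 (a * b)‖ ≤ _
  rw [← norm_toL2_star, star_mul, toL2_mul, ← A.norm_toL2_star a]
  exact ContinuousLinearMap.le_opNorm _ _

theorem rightMul_mem_commutant (b : A.Elem) : A.rightMul b ∈ A.alg.commutant := by
  rw [VonNeumannAlgebra.mem_commutant_iff]
  intro a ha
  refine ext_toL2 (A := A) fun c => ?_
  change a (A.rightMul b (A.toL2 c)) = A.rightMul b (A.toL2 (⟨a, ha⟩ * c))
  rw [rightMul_toL2, rightMul_toL2, mul_assoc]
  rfl

variable {A} (σ : Γ →* (A.Elem ≃⋆ₐ[ℂ] A.Elem))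

/-- The operator on `L²(A)` implementing `σ_g`, that is, `â ↦ (σ_g a)^`. -/
def implement (g : Γ) : K →L[ℂ] K :=
  (A.toL2 ∘ₗ (σ g).toAlgEquiv.toLinearMap).extendOfNorm A.toL2

theorem action_mul (g h : Γ) (a : A.Elem) : σ (g * h) a = σ g (σ h a) := by
  rw [map_mul]; rfl

theorem action_one (a : A.Elem) : σ 1 a = a := by
  rw [map_one]; rfl

variable {σ} (hσ : ∀ g a, A.trace (σ g a) = A.trace a)
include hσ

theorem implement_toL2 (g : Γ) (a : A.Elem) : implement σ g (A.toL2 a) = A.toL2 (σ g a) := by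
  refine LinearMap.extendOfNorm_eq A.denseRange_toL2 ⟨1, fun a => ?_⟩ a
  change ‖A.toL2 (σ g a)‖ ≤ _
  rw [one_mul, @norm_eq_sqrt_re_inner ℂ, @norm_eq_sqrt_re_inner ℂ, inner_toL2, inner_toL2,
    ← map_star, ← map_mul, hσ]

theorem implement_vac (g : Γ) : implement σ g A.vac = A.vac := by
  rw [← toL2_one, implement_toL2 hσ, map_one]

theorem implement_mul (g h : Γ) : implement σ (g * h) = implement σ g * implement σ h :=
  ext_toL2 (A := A) fun a => by
    rw [mul_apply_eq_comp, implement_toL2 hσ, implement_toL2 hσ, implement_toL2 hσ, action_mul]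

theorem implement_one : implement σ 1 = 1 :=
  ext_toL2 (A := A) fun a => by
    rw [implement_toL2 hσ, action_one]; rfl

theorem implement_implement_inv (g : Γ) (ξ : K) :
    implement σ g (implement σ g⁻¹ ξ) = ξ := by
  rw [← mul_apply_eq_comp, ← implement_mul hσ, mul_inv_cancel, implement_one hσ]; rfl

theorem implement_apply (g : Γ) (a : A.Elem) (ξ : K) :
    implement σ g ((a : K →L[ℂ] K) ξ) = ((σ g a : A.Elem) : K →L[ℂ] K) (implement σ g ξ) := by
  have : implement σ g * (a : K →L[ℂ] K) = ((σ g a : A.Elem) : K →L[ℂ] K) * implement σ g :=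
    ext_toL2 (A := A) fun b => by
      rw [mul_apply_eq_comp, mul_apply_eq_comp, ← toL2_mul, implement_toL2 hσ,
        implement_toL2 hσ, ← toL2_mul, map_mul]
  exact DFunLike.congr_fun this ξ

end TracialVonNeumannAlgebra

section Generated

variable {H : Type u} [NormedAddCommGroup H] [InnerProductSpace ℂ H] [CompleteSpace H]

theorem mem_generatedVonNeumannAlgebra_iff {S : Set (H →L[ℂ] H)} {x : H →L[ℂ] H} :
    x ∈ generatedVonNeumannAlgebra S ↔
      ∀ T, (∀ s ∈ S, s * T = T * s ∧ star s * T = T * star s) → T * x = x * T := by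
  change x ∈ StarSubalgebra.centralizer ℂ (StarSubalgebra.centralizer ℂ S : Set (H →L[ℂ] H)) ↔ _
  rw [StarSubalgebra.mem_centralizer_iff]
  constructor
  · intro h T hT
    exact (h T ((StarSubalgebra.mem_centralizer_iff ℂ).2 hT)).1
  · intro h T hT
    have hT' := (StarSubalgebra.mem_centralizer_iff ℂ).1 hT
    have hsT := (StarSubalgebra.mem_centralizer_iff ℂ).1 (star_mem hT)
    exact ⟨h T hT', h _ hsT⟩

end Generated

theorem crossedRep_apply_inv {A : TracialVonNeumannAlgebra K}
    (σ : Γ →* (A.Elem ≃⋆ₐ[ℂ] A.Elem)) (a : A.Elem) (ξ : L2 Γ K) (h : Γ) :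
    crossedRep A σ a ξ h = ((σ h⁻¹ a : A.Elem) : K →L[ℂ] K) (ξ h) := by
  rw [crossedRep_apply, map_inv]

theorem star_leftTranslation (g : Γ) : star (leftTranslation K g) = leftTranslation K g⁻¹ := by
  rw [ContinuousLinearMap.star_eq_adjoint]
  symm
  rw [ContinuousLinearMap.eq_adjoint_iff]
  intro ξ η
  rw [lp.inner_eq_tsum, lp.inner_eq_tsum, ← (Equiv.mulLeft g⁻¹).tsum_eq]
  refine tsum_congr fun h => ?_
  rw [leftTranslation_apply, leftTranslation_apply, Equiv.coe_mulLeft, inv_inv, mul_inv_cancel_left]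

section Rep

variable {A : TracialVonNeumannAlgebra K} (σ : Γ →* (A.Elem ≃⋆ₐ[ℂ] A.Elem))

theorem star_crossedRep (a : A.Elem) : star (crossedRep A σ a) = crossedRep A σ (star a) := by
  rw [ContinuousLinearMap.star_eq_adjoint]
  symm
  rw [ContinuousLinearMap.eq_adjoint_iff]
  intro ξ η
  rw [lp.inner_eq_tsum, lp.inner_eq_tsum]
  refine tsum_congr fun h => ?_
  rw [crossedRep_apply, crossedRep_apply, map_star]
  exact inner_star_left _ _ _

theorem crossedRep_mul (a b : A.Elem) :
    crossedRep A σ (a * b) = crossedRep A σ a * crossedRep A σ b := by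
  ext ξ h
  rw [mul_apply_eq_comp, crossedRep_apply, crossedRep_apply, crossedRep_apply, map_mul]
  rfl

/-- The covariance relation `λ_g π(a) λ_g* = π(σ_g a)`. -/
theorem leftTranslation_mul_crossedRep (g : Γ) (a : A.Elem) :
    leftTranslation K g * crossedRep A σ a = crossedRep A σ (σ g a) * leftTranslation K g := by
  ext ξ h
  rw [mul_apply_eq_comp, mul_apply_eq_comp, leftTranslation_apply, crossedRep_apply_inv,
    crossedRep_apply_inv, leftTranslation_apply, ← TracialVonNeumannAlgebra.action_mul,
    mul_inv_rev, inv_inv]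

theorem mem_crossedProduct_iff {L : Subgroup Γ} {x : L2 Γ K →L[ℂ] L2 Γ K} :
    x ∈ crossedProduct A σ L ↔ ∀ T, (∀ a, crossedRep A σ a * T = T * crossedRep A σ a) →
      (∀ g ∈ L, leftTranslation K g * T = T * leftTranslation K g) → T * x = x * T := by
  rw [crossedProduct, mem_generatedVonNeumannAlgebra_iff]
  constructor
  · intro h T h1 h2
    refine h T ?_
    rintro _ (⟨a, rfl⟩ | ⟨g, hg, rfl⟩)
    · exact ⟨h1 a, by rw [star_crossedRep]; exact h1 _⟩
    · exact ⟨h2 g hg, by rw [star_leftTranslation]; exact h2 _ (inv_mem hg)⟩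
  · intro h T hT
    exact h T (fun a => (hT _ (Or.inl ⟨a, rfl⟩)).1) fun g hg => (hT _ (Or.inr ⟨g, hg, rfl⟩)).1

theorem crossedRep_mem_crossedProduct (L : Subgroup Γ) (a : A.Elem) :
    crossedRep A σ a ∈ crossedProduct A σ L :=
  (mem_crossedProduct_iff σ).2 fun _ h1 _ => (h1 a).symm

theorem leftTranslation_mem_crossedProduct {L : Subgroup Γ} {g : Γ} (hg : g ∈ L) :
    leftTranslation K g ∈ crossedProduct A σ L :=
  (mem_crossedProduct_iff σ).2 fun _ _ h2 => (h2 g hg).symm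

theorem crossedProduct_mono {L L' : Subgroup Γ} (h : L ≤ L') :
    crossedProduct A σ L ≤ crossedProduct A σ L' := fun _ hx =>
  (mem_crossedProduct_iff σ).2 fun T h1 h2 =>
    (mem_crossedProduct_iff σ).1 hx T h1 fun g hg => h2 g (h hg)

end Rep

section Commutant

variable {A : TracialVonNeumannAlgebra K} {σ : Γ →* (A.Elem ≃⋆ₐ[ℂ] A.Elem)}

theorem ampliation_mem_commutant {T : K →L[ℂ] K} (hT : T ∈ A.alg.commutant) :
    ampliation Γ T ∈ (crossedProduct A σ ⊤).commutant := by
  rw [VonNeumannAlgebra.mem_commutant_iff]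
  intro x hx
  refine ((mem_crossedProduct_iff σ).1 hx _ (fun a => ?_) fun g _ => ?_).symm
  · ext ξ h
    rw [mul_apply_eq_comp, mul_apply_eq_comp, ampliation_apply, crossedRep_apply,
      crossedRep_apply, ampliation_apply]
    exact DFunLike.congr_fun (VonNeumannAlgebra.mem_commutant_iff.1 hT _ ((σ h)⁻¹ a).2) (ξ h)
  · ext ξ h
    rfl

open TracialVonNeumannAlgebra in
/-- The right regular operators `(ρ_g ξ)(h) = u_g ξ(hg)`, where `u_g` implements `σ_g`, commute
with the crossed product. -/
theorem implement_rightTranslation_mem_commutant (hσ : ∀ g a, A.trace (σ g a) = A.trace a)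
    (g : Γ) : ampliation Γ (implement σ g) * rightTranslation K g ∈
      (crossedProduct A σ ⊤).commutant := by
  rw [VonNeumannAlgebra.mem_commutant_iff]
  intro x hx
  refine ((mem_crossedProduct_iff σ).1 hx _ (fun a => ?_) fun k _ => ?_).symm
  · ext ξ h
    simp only [mul_apply_eq_comp, ampliation_apply, crossedRep_apply_inv, rightTranslation_apply]
    rw [implement_apply hσ, ← action_mul, mul_inv_rev, mul_inv_cancel_left]
  · ext ξ h
    simp only [mul_apply_eq_comp, ampliation_apply, leftTranslation_apply, rightTranslation_apply,
      mul_assoc]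

end Commutant

end CrossedProductStructure

/-! ### Matrix entries of elements of the crossed product -/

section MatrixEntries

open TracialVonNeumannAlgebra

variable {K : Type u} [NormedAddCommGroup K] [InnerProductSpace ℂ K]
variable {Γ : Type v}

open scoped Classical in
/-- The `(h, k)` entry of an operator on `ℓ²(Γ, K)`, an operator on `K`. -/
def entry (x : L2 Γ K →L[ℂ] L2 Γ K) (h k : Γ) : K →L[ℂ] K :=
  lp.evalCLM ℂ (fun _ : Γ => K) 2 h ∘L x ∘L lp.singleContinuousLinearMap ℂ (fun _ : Γ => K) 2 k

open scoped Classical in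
theorem entry_apply (x : L2 Γ K →L[ℂ] L2 Γ K) (h k : Γ) (ξ : K) :
    entry x h k ξ = x (lp.single 2 k ξ) h := rfl

theorem ext_entry {x y : L2 Γ K →L[ℂ] L2 Γ K} (h : ∀ g k, entry x g k = entry y g k) : x = y := by
  classical
  refine L2.ext_single fun k ξ => ?_
  ext g
  have := DFunLike.congr_fun (h g k) ξ
  simpa only [entry_apply] using this

/-- Matrix multiplication: the entries of `x` act on vectors in the usual way. -/
theorem hasSum_entry (x : L2 Γ K →L[ℂ] L2 Γ K) (η : L2 Γ K) (h : Γ) :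
    HasSum (fun l => entry x h l (η l)) (x η h) := by
  classical
  have h1 := (lp.hasSum_single (E := fun _ : Γ => K) (p := 2) (by norm_num) η).mapL x
  have h2 := h1.mapL (lp.evalCLM ℂ (fun _ : Γ => K) 2 h)
  refine h2.congr_fun ?_
  intro l
  rfl

theorem isPositive_entry_self {T : L2 Γ K →L[ℂ] L2 Γ K} (hT : T.IsPositive) (h : Γ) :
    (entry T h h).IsPositive := by
  classical
  rw [ContinuousLinearMap.isPositive_iff_complex] at hT ⊢
  intro ξ
  have h1 := hT (lp.single 2 h ξ)
  rwa [lp.inner_single_right, ← entry_apply] at h1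

variable [CompleteSpace K] [Group Γ]
variable {A : TracialVonNeumannAlgebra K} {σ : Γ →* (A.Elem ≃⋆ₐ[ℂ] A.Elem)}

theorem crossedRep_single [DecidableEq Γ] (a : A.Elem) (k : Γ) (ξ : K) :
    crossedRep A σ a (lp.single 2 k ξ) =
      lp.single 2 k (((σ k⁻¹ a : A.Elem) : K →L[ℂ] K) ξ) := by
  ext j
  rw [crossedRep_apply_inv]
  rcases eq_or_ne j k with rfl | hne
  · rw [lp.single_apply_self, lp.single_apply_self]
  · rw [lp.single_apply_ne _ _ _ hne, lp.single_apply_ne _ _ _ hne, map_zero]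

theorem entry_crossedRep_self (a : A.Elem) (h : Γ) :
    entry (crossedRep A σ a) h h = ((σ h⁻¹ a : A.Elem) : K →L[ℂ] K) := by
  classical
  ext ξ
  rw [entry_apply, crossedRep_apply_inv, lp.single_apply_self]

theorem entry_mem_alg {x : L2 Γ K →L[ℂ] L2 Γ K} (hx : x ∈ crossedProduct A σ ⊤) (h k : Γ) :
    entry x h k ∈ A.alg := by
  classical
  rw [← A.alg.commutant_commutant, VonNeumannAlgebra.mem_commutant_iff]
  intro T hT
  ext ξ
  have h1 := VonNeumannAlgebra.mem_commutant_iff.1 (ampliation_mem_commutant hT) x hx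
  have h2 := DFunLike.congr_fun h1 (lp.single 2 k ξ)
  rw [mul_apply_eq_comp, mul_apply_eq_comp, ampliation_single] at h2
  rw [mul_apply_eq_comp, mul_apply_eq_comp, entry_apply, entry_apply, h2, ampliation_apply]

/-- The entries of an element of the crossed product, as elements of `A`. -/
def coeff {x : L2 Γ K →L[ℂ] L2 Γ K} (hx : x ∈ crossedProduct A σ ⊤) (h k : Γ) : A.Elem :=
  ⟨entry x h k, entry_mem_alg hx h k⟩

theorem coe_coeff {x : L2 Γ K →L[ℂ] L2 Γ K} (hx : x ∈ crossedProduct A σ ⊤) (h k : Γ) :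
    (coeff hx h k : K →L[ℂ] K) = entry x h k := rfl

theorem implement_rightTranslation_single [DecidableEq Γ] (g k : Γ) (ξ : K) :
    ampliation Γ (implement σ g) (rightTranslation K g (lp.single 2 (k * g) ξ)) =
      lp.single 2 k (implement σ g ξ) := by
  rw [← ampliation_single]
  congr 1
  ext h
  rw [rightTranslation_apply]
  rcases eq_or_ne h k with rfl | hne
  · rw [lp.single_apply_self, lp.single_apply_self]
  · rw [lp.single_apply_ne _ _ _ hne, lp.single_apply_ne]
    exact fun h' => hne (mul_right_cancel h')

/-- The matrix of an element of the crossed product is constant, up to the action, along the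
diagonals `{(hg, kg)}`. -/
theorem action_coeff (hσ : ∀ g a, A.trace (σ g a) = A.trace a) {x : L2 Γ K →L[ℂ] L2 Γ K}
    (hx : x ∈ crossedProduct A σ ⊤) (h k g : Γ) :
    σ g (coeff hx (h * g) (k * g)) = coeff hx h k := by
  classical
  apply Subtype.ext
  ext ξ
  obtain ⟨η, rfl⟩ : ∃ η, implement σ g η = ξ := ⟨_, implement_implement_inv hσ g ξ⟩
  rw [← implement_apply hσ, coe_coeff, coe_coeff, entry_apply, entry_apply,
    ← implement_rightTranslation_single]
  have h1 := VonNeumannAlgebra.mem_commutant_iff.1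
    (implement_rightTranslation_mem_commutant (σ := σ) hσ g) x hx
  have h2 := DFunLike.congr_fun h1 (lp.single 2 (k * g) η)
  simp only [mul_apply_eq_comp] at h2
  rw [h2, ampliation_apply, rightTranslation_apply]

theorem coeff_eq (hσ : ∀ g a, A.trace (σ g a) = A.trace a) {x : L2 Γ K →L[ℂ] L2 Γ K}
    (hx : x ∈ crossedProduct A σ ⊤) (h k : Γ) :
    coeff hx h k = σ k⁻¹ (coeff hx (h * k⁻¹) 1) := by
  rw [← action_coeff hσ hx (h * k⁻¹) 1 k, ← action_mul, inv_mul_cancel, action_one,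
    inv_mul_cancel_right, one_mul]

/-- The trace vector `δ_e ⊗ 1̂` of the crossed product. -/
def crossedVac (Γ : Type v) [Group Γ] (A : TracialVonNeumannAlgebra K) : L2 Γ K :=
  letI := Classical.decEq Γ
  lp.single 2 1 A.vac

open scoped Classical in
theorem crossedVac_eq : crossedVac Γ A = lp.single 2 1 A.vac := rfl

theorem norm_crossedVac : ‖crossedVac Γ A‖ = 1 := by
  classical
  rw [crossedVac_eq, L2.norm_single, A.norm_vac]

theorem inner_crossedVac_left (x : L2 Γ K →L[ℂ] L2 Γ K) :
    ⟪crossedVac Γ A, x (crossedVac Γ A)⟫_ℂ = ⟪A.vac, entry x 1 1 A.vac⟫_ℂ := by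
  classical
  rw [crossedVac_eq, lp.inner_single_left, entry_apply]

theorem hasSum_trace_mul {x y : L2 Γ K →L[ℂ] L2 Γ K} (hx : x ∈ crossedProduct A σ ⊤)
    (hy : y ∈ crossedProduct A σ ⊤) :
    HasSum (fun l => A.trace (coeff hx 1 l * coeff hy l 1))
      ⟪crossedVac Γ A, (x * y) (crossedVac Γ A)⟫_ℂ := by
  classical
  rw [inner_crossedVac_left, entry_apply, mul_apply_eq_comp]
  exact (hasSum_entry x (y (lp.single 2 1 A.vac)) 1).mapL (innerSL ℂ A.vac)

theorem isTraceVector_crossedVac (hσ : ∀ g a, A.trace (σ g a) = A.trace a) :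
    IsTraceVector (crossedProduct A σ ⊤) (crossedVac Γ A) := by
  intro x hx y hy
  refine (hasSum_trace_mul hx hy).unique ?_
  have h := hasSum_trace_mul hy hx
  rw [← (Equiv.inv Γ).hasSum_iff] at h
  refine h.congr_fun ?_
  intro l
  have h1 : coeff hx 1 l = σ l⁻¹ (coeff hx l⁻¹ 1) := by rw [coeff_eq hσ hx, one_mul]
  have h2 : coeff hy l 1 = σ l⁻¹ (coeff hy 1 l⁻¹) := by
    rw [← action_coeff hσ hy 1 l⁻¹ l, ← action_mul, inv_mul_cancel, action_one, one_mul]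
  rw [h1, h2, ← map_mul, hσ, A.trace_mul_comm]
  rfl

/-- Vectors in the orbit of the trace vector under the commutant of the crossed product are total;
countably many suffice. -/
theorem exists_total_commutant [Countable Γ] [TopologicalSpace.SeparableSpace K]
    (hσ : ∀ g a, A.trace (σ g a) = A.trace a) :
    ∃ S : Γ × ℕ → L2 Γ K →L[ℂ] L2 Γ K, (∀ i, S i ∈ (crossedProduct A σ ⊤).commutant) ∧
      ∀ ξ, (∀ i, ⟪S i (crossedVac Γ A), ξ⟫_ℂ = 0) → ξ = 0 := by
  classical
  obtain ⟨a, ha⟩ : ∃ a : ℕ → A.Elem, DenseRange fun n => A.toL2 (a n) := by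
    have : Nonempty (Set.range A.toL2) := ⟨⟨_, ⟨0, rfl⟩⟩⟩
    have h1 : DenseRange (Subtype.val : Set.range A.toL2 → K) := A.denseRange_toL2.denseRange_val
    have h2 := h1.comp (TopologicalSpace.denseRange_denseSeq (Set.range A.toL2))
      continuous_subtype_val
    choose a ha using fun n => (TopologicalSpace.denseSeq (Set.range A.toL2) n).2
    refine ⟨a, ?_⟩
    have h3 : (fun n => A.toL2 (a n)) =
        Subtype.val ∘ TopologicalSpace.denseSeq (Set.range A.toL2) := funext ha
    rwa [h3]
  refine ⟨fun i => ampliation Γ (A.rightMul (a i.2)) *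
    (ampliation Γ (implement σ i.1⁻¹) * rightTranslation K i.1⁻¹), fun i => ?_, fun ξ hξ => ?_⟩
  · exact mul_mem (ampliation_mem_commutant (A.rightMul_mem_commutant _))
      (implement_rightTranslation_mem_commutant hσ _)
  · ext h
    refine ha.eq_zero_of_inner_right ℂ ?_
    intro n
    have h1 := hξ (h, n)
    have h2 : (lp.single 2 1 A.vac : L2 Γ K) = lp.single 2 (h * h⁻¹) A.vac := by
      rw [mul_inv_cancel]
    rw [mul_apply_eq_comp, mul_apply_eq_comp, crossedVac_eq, h2,
      implement_rightTranslation_single, ampliation_single, lp.inner_single_left,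
      implement_vac hσ, ← A.toL2_one, A.rightMul_toL2, one_mul] at h1
    exact h1

/-- An element of the crossed product whose matrix is supported on `{(h, k) : h k⁻¹ ∈ L}` lies in
the crossed product by `L`: it commutes entrywise with everything in the commutant of the latter,
so no convergence of Fourier series is needed. -/
theorem mem_crossedProduct_of_entry_eq_zero (hσ : ∀ g a, A.trace (σ g a) = A.trace a)
    {L : Subgroup Γ} {x : L2 Γ K →L[ℂ] L2 Γ K} (hx : x ∈ crossedProduct A σ ⊤)
    (h0 : ∀ h k, h * k⁻¹ ∉ L → entry x h k = 0) : x ∈ crossedProduct A σ L := by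
  classical
  rw [mem_crossedProduct_iff]
  intro T hπ hL
  have hTπ : ∀ h k (a : A.Elem) ξ, entry T h k (((σ k⁻¹ a : A.Elem) : K →L[ℂ] K) ξ) =
      ((σ h⁻¹ a : A.Elem) : K →L[ℂ] K) (entry T h k ξ) := by
    intro h k a ξ
    have h1 := congrArg (fun v : L2 Γ K => v h) (DFunLike.congr_fun (hπ a) (lp.single 2 k ξ))
    rw [mul_apply_eq_comp, mul_apply_eq_comp, crossedRep_single] at h1
    rw [entry_apply, entry_apply, ← h1, crossedRep_apply_inv]
  have hTL : ∀ h k, ∀ s ∈ L, ∀ ξ, entry T (s * h) (s * k) ξ = entry T h k ξ := by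
    intro h k s hs ξ
    have h1 := congrArg (fun v : L2 Γ K => v (s * h))
      (DFunLike.congr_fun (hL s hs) (lp.single 2 k ξ))
    simp only [mul_apply_eq_comp, leftTranslation_apply, leftTranslation_single,
      inv_mul_cancel_left] at h1
    rw [entry_apply, entry_apply, h1]
  refine L2.ext_single fun k ξ => ?_
  ext h
  rw [mul_apply_eq_comp, mul_apply_eq_comp]
  have h1 := hasSum_entry T (x (lp.single 2 k ξ)) h
  have h2 := hasSum_entry x (T (lp.single 2 k ξ)) h
  let e : Γ ≃ Γ := (Equiv.inv Γ).trans ((Equiv.mulLeft h).trans (Equiv.mulRight k))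
  rw [← e.hasSum_iff] at h1
  refine h1.unique (h2.congr_fun ?_)
  intro l
  change entry T h (h * l⁻¹ * k) (entry x (h * l⁻¹ * k) k ξ) = entry x h l (entry T l k ξ)
  by_cases hs : h * l⁻¹ ∈ L
  · have e1 : coeff hx h l = σ h⁻¹ (σ (h * l⁻¹) (coeff hx (h * l⁻¹) 1)) := by
      rw [coeff_eq hσ hx, ← action_mul, inv_mul_cancel_left]
    have e2 : coeff hx (h * l⁻¹ * k) k =
        σ (h * l⁻¹ * k)⁻¹ (σ (h * l⁻¹) (coeff hx (h * l⁻¹) 1)) := by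
      rw [coeff_eq hσ hx, ← action_mul, mul_inv_cancel_right]
      congr 2
      group
    rw [← coe_coeff hx, ← coe_coeff hx, e1, e2, hTπ]
    congr 1
    rw [← hTL l k _ hs, inv_mul_cancel_right]
  · rw [h0 h l hs, h0 (h * l⁻¹ * k) k (by rwa [mul_inv_cancel_right])]
    simp

end MatrixEntries

/-! ### Averaging functionals over the group -/

section Dynamics

open scoped ComplexOrder

variable {K : Type u} [NormedAddCommGroup K] [InnerProductSpace ℂ K]
variable {Γ : Type v}

open scoped Classical in
/-- The multiplication operator by a function `f` on `Γ`; the junk value `0` is used for unbounded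
functions. -/
def mulOp (K : Type u) [NormedAddCommGroup K] [InnerProductSpace ℂ K] (f : Γ → ℂ) :
    L2 Γ K →L[ℂ] L2 Γ K :=
  if hf : BddAbove (Set.range fun h => ‖f h‖) then
    lp.mapCLM 2 (fun h => f h • (ContinuousLinearMap.id ℂ K)) (K := ⨆ h, ‖f h‖)
      (Real.iSup_nonneg fun h => norm_nonneg _) (fun h => by
        refine (norm_smul_le _ _).trans ?_
        exact (mul_le_of_le_one_right (norm_nonneg _) ContinuousLinearMap.norm_id_le).trans
          (le_ciSup hf h))
  else 0

theorem mulOp_apply {f : Γ → ℂ} {C : ℝ} (hf : ∀ h, ‖f h‖ ≤ C) (ξ : L2 Γ K) (h : Γ) :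
    mulOp K f ξ h = f h • ξ h := by
  have hf' : BddAbove (Set.range fun h => ‖f h‖) := ⟨C, by rintro _ ⟨h, rfl⟩; exact hf h⟩
  rw [mulOp, dif_pos hf']
  rfl

theorem mulOp_add {f f' : Γ → ℂ} {C C' : ℝ} (hf : ∀ h, ‖f h‖ ≤ C) (hf' : ∀ h, ‖f' h‖ ≤ C') :
    mulOp K (fun h => f h + f' h) = mulOp K f + mulOp K f' := by
  ext ξ h
  have h3 : ∀ h, ‖f h + f' h‖ ≤ C + C' := fun h =>
    (norm_add_le _ _).trans (add_le_add (hf h) (hf' h))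
  rw [mulOp_apply h3, add_smul, ← mulOp_apply hf, ← mulOp_apply hf']
  rfl

theorem mulOp_mul {f f' : Γ → ℂ} {C C' : ℝ} (hf : ∀ h, ‖f h‖ ≤ C) (hf' : ∀ h, ‖f' h‖ ≤ C') :
    mulOp K (fun h => f h * f' h) = mulOp K f * mulOp K f' := by
  ext ξ h
  have h3 : ∀ h, ‖f h * f' h‖ ≤ C * C' := fun h => by
    rw [norm_mul]
    exact mul_le_mul (hf h) (hf' h) (norm_nonneg _) ((norm_nonneg _).trans (hf h))
  rw [mulOp_apply h3, mul_smul, ← mulOp_apply hf', mul_apply_eq_comp, mulOp_apply hf]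

theorem mulOp_const (c : ℂ) : mulOp K (fun _ : Γ => c) = c • 1 := by
  ext ξ h
  rw [mulOp_apply (C := ‖c‖) fun _ => le_rfl]
  rfl

theorem mulOp_smul (c : ℂ) {f : Γ → ℂ} {C : ℝ} (hf : ∀ h, ‖f h‖ ≤ C) :
    mulOp K (fun h => c * f h) = c • mulOp K f := by
  rw [mulOp_mul (C := ‖c‖) (fun _ => le_rfl) hf, mulOp_const, smul_mul_assoc, one_mul]

section conjTranslation

variable [Group Γ]

/-- The conjugate `λ_g* T λ_g`. -/
def conjTranslation (g : Γ) (T : L2 Γ K →L[ℂ] L2 Γ K) : L2 Γ K →L[ℂ] L2 Γ K :=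
  leftTranslation K g⁻¹ * T * leftTranslation K g

variable (g h : Γ) (S T : L2 Γ K →L[ℂ] L2 Γ K)

theorem conjTranslation_conjTranslation :
    conjTranslation h (conjTranslation g T) = conjTranslation (g * h) T := by
  simp only [conjTranslation, leftTranslation_mul, mul_inv_rev, mul_assoc]

theorem conjTranslation_one_left : conjTranslation (1 : Γ) T = T := by
  rw [conjTranslation, inv_one, leftTranslation_one, one_mul, mul_one]

theorem conjTranslation_add :
    conjTranslation g (S + T) = conjTranslation g S + conjTranslation g T := by
  rw [conjTranslation, mul_add, add_mul]; rfl

theorem conjTranslation_smul (c : ℂ) : conjTranslation g (c • T) = c • conjTranslation g T := by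
  rw [conjTranslation, mul_smul_comm, smul_mul_assoc]; rfl

theorem conjTranslation_mul :
    conjTranslation g (S * T) = conjTranslation g S * conjTranslation g T := by
  have h : leftTranslation K g⁻¹ * S * leftTranslation K g *
      (leftTranslation K g⁻¹ * T * leftTranslation K g) =
      leftTranslation K g⁻¹ * S * (leftTranslation K g * leftTranslation K g⁻¹) * T *
        leftTranslation K g := by
    simp only [mul_assoc]
  rw [conjTranslation, conjTranslation, conjTranslation, h, leftTranslation_mul_inv]
  simp only [mul_assoc, one_mul]

theorem conjTranslation_one_right : conjTranslation g (1 : L2 Γ K →L[ℂ] L2 Γ K) = 1 := by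
  rw [conjTranslation, mul_one, leftTranslation_inv_mul]

theorem conjTranslation_mulOp {f : Γ → ℂ} {C : ℝ} (hf : ∀ h, ‖f h‖ ≤ C) :
    conjTranslation g (mulOp K f) = mulOp K (fun h => f (g * h)) := by
  ext ξ h
  rw [conjTranslation, mul_apply_eq_comp, mul_apply_eq_comp, leftTranslation_apply,
    mulOp_apply hf, mulOp_apply (fun h => hf (g * h)), leftTranslation_apply, inv_inv,
    inv_mul_cancel_left]

theorem entry_conjTranslation (x : L2 Γ K →L[ℂ] L2 Γ K) (g h k : Γ) :
    entry (conjTranslation g x) h k = entry x (g * h) (g * k) := by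
  classical
  ext ξ
  rw [entry_apply, conjTranslation, mul_apply_eq_comp, mul_apply_eq_comp, leftTranslation_single,
    leftTranslation_apply, inv_inv, entry_apply]

/-- The orbit function `h ↦ χ(λ_h* T λ_h)` of an operator under a functional. -/
def orbitFun (χ : (L2 Γ K →L[ℂ] L2 Γ K) → ℂ) (T : L2 Γ K →L[ℂ] L2 Γ K) (h : Γ) : ℂ :=
  χ (conjTranslation h T)

/-- The average of the translates of `χ` with respect to the mean on `Γ` obtained by restricting
`ψ` to multiplication operators. Averaging `χ` in this way replaces taking limits of convex
combinations of translates. -/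
def average (ψ χ : (L2 Γ K →L[ℂ] L2 Γ K) → ℂ) (T : L2 Γ K →L[ℂ] L2 Γ K) : ℂ :=
  ψ (mulOp K (orbitFun χ T))

theorem orbitFun_average (ψ χ : (L2 Γ K →L[ℂ] L2 Γ K) → ℂ) (T : L2 Γ K →L[ℂ] L2 Γ K) (h : Γ) :
    orbitFun (average ψ χ) T h = ψ (mulOp K fun k => orbitFun χ T (h * k)) := by
  rw [orbitFun, average]
  congr 2
  ext k
  rw [orbitFun, orbitFun, conjTranslation_conjTranslation]

/-- A set of functionals that is stable under averaging over `Γ`. -/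
def IsAverageStable (D : Set ((L2 Γ K →L[ℂ] L2 Γ K) → ℂ)) : Prop :=
  ∀ ψ, IsState ψ → ∀ χ ∈ D, average ψ χ ∈ D

/-- The stabilizer of a functional under the conjugation action of `Γ`. -/
def stateStabilizer (ε : (L2 Γ K →L[ℂ] L2 Γ K) → ℂ) : Subgroup Γ where
  carrier := {g | ∀ T, ε (conjTranslation g T) = ε T}
  mul_mem' {g h} hg hh T := by rw [← conjTranslation_conjTranslation, hh, hg]
  one_mem' T := by rw [conjTranslation_one_left]
  inv_mem' {g} hg T := by
    rw [← hg, conjTranslation_conjTranslation, inv_mul_cancel, conjTranslation_one_left]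

theorem mem_stateStabilizer {ε : (L2 Γ K →L[ℂ] L2 Γ K) → ℂ} {g : Γ} :
    g ∈ stateStabilizer ε ↔ ∀ T, ε (conjTranslation g T) = ε T := Iff.rfl

end conjTranslation

variable [CompleteSpace K]

theorem star_mulOp {f : Γ → ℂ} {C : ℝ} (hf : ∀ h, ‖f h‖ ≤ C) :
    star (mulOp K f) = mulOp K (fun h => star (f h)) := by
  have hf' : ∀ h, ‖star (f h)‖ ≤ C := fun h => by rw [norm_star]; exact hf h
  rw [ContinuousLinearMap.star_eq_adjoint]
  symm
  rw [ContinuousLinearMap.eq_adjoint_iff]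
  intro ξ η
  rw [lp.inner_eq_tsum, lp.inner_eq_tsum]
  refine tsum_congr fun h => ?_
  rw [mulOp_apply hf, mulOp_apply hf', inner_smul_left, inner_smul_right]
  simp

theorem isPositive_mulOp {f : Γ → ℂ} {C : ℝ} (hf : ∀ h, ‖f h‖ ≤ C) (h0 : ∀ h, 0 ≤ f h) :
    (mulOp K f).IsPositive := by
  rw [ContinuousLinearMap.isPositive_iff']
  refine ⟨?_, fun ξ => ?_⟩
  · rw [IsSelfAdjoint, star_mulOp hf]
    congr 1
    ext h
    exact (IsSelfAdjoint.of_nonneg (h0 h)).star_eq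
  · rw [lp.inner_eq_tsum]
    refine tsum_nonneg fun h => ?_
    rw [mulOp_apply hf, inner_smul_left, starRingEnd_apply,
      (IsSelfAdjoint.of_nonneg (h0 h)).star_eq]
    exact mul_nonneg (h0 h)
      ((ContinuousLinearMap.isPositive_one (𝕜 := ℂ) (E := K)).inner_nonneg_right (ξ h))

variable [Group Γ]

theorem conjTranslation_isPositive (g : Γ) {T : L2 Γ K →L[ℂ] L2 Γ K} (hT : T.IsPositive) :
    (conjTranslation g T).IsPositive := by
  rw [← ContinuousLinearMap.nonneg_iff_isPositive] at hT ⊢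
  rw [conjTranslation, ← star_leftTranslation]
  exact star_left_conjugate_nonneg hT _

theorem star_conjTranslation (g : Γ) (T : L2 Γ K →L[ℂ] L2 Γ K) :
    star (conjTranslation g T) = conjTranslation g (star T) := by
  simp only [conjTranslation, star_mul, star_leftTranslation, inv_inv, mul_assoc]

theorem IsState.comp_conjTranslation {χ : (L2 Γ K →L[ℂ] L2 Γ K) → ℂ} (hχ : IsState χ) (g : Γ) :
    IsState fun T => χ (conjTranslation g T) where
  map_add S T := by rw [conjTranslation_add, hχ.map_add]
  map_smul c T := by rw [conjTranslation_smul, hχ.map_smul]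
  map_nonneg T hT := hχ.map_nonneg _ (conjTranslation_isPositive g hT)
  map_one := by rw [conjTranslation_one_right, hχ.map_one]

theorem IsState.norm_orbitFun_le {χ : (L2 Γ K →L[ℂ] L2 Γ K) → ℂ} (hχ : IsState χ)
    (T : L2 Γ K →L[ℂ] L2 Γ K) (h : Γ) : ‖orbitFun χ T h‖ ≤ ‖T‖ :=
  (hχ.comp_conjTranslation h).norm_le T

theorem IsState.average {ψ χ : (L2 Γ K →L[ℂ] L2 Γ K) → ℂ} (hψ : IsState ψ) (hχ : IsState χ) :
    IsState (average ψ χ) where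
  map_add S T := by
    rw [_root_.average, _root_.average, _root_.average, ← hψ.map_add,
      ← mulOp_add (hχ.norm_orbitFun_le S) (hχ.norm_orbitFun_le T)]
    congr 2
    ext h
    exact (hχ.comp_conjTranslation h).map_add S T
  map_smul c T := by
    rw [_root_.average, _root_.average, ← hψ.map_smul, ← mulOp_smul c (hχ.norm_orbitFun_le T)]
    congr 2
    ext h
    exact (hχ.comp_conjTranslation h).map_smul c T
  map_nonneg T hT := hψ.map_nonneg _ (isPositive_mulOp (hχ.norm_orbitFun_le T) fun h =>
    (hχ.comp_conjTranslation h).map_nonneg T hT)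
  map_one := by
    have : orbitFun χ 1 = fun _ => 1 := funext fun h => (hχ.comp_conjTranslation h).map_one
    rw [_root_.average, this, mulOp_const, one_smul, hψ.map_one]

/-- Averaging is associative. -/
theorem average_average {ψ χ φ : (L2 Γ K →L[ℂ] L2 Γ K) → ℂ} (hφ : IsState φ) :
    average (average ψ χ) φ = average ψ (average χ φ) := by
  ext T
  rw [average, average, average]
  congr 2
  ext h
  rw [orbitFun_average, orbitFun, conjTranslation_mulOp h (hφ.norm_orbitFun_le T)]

theorem average_smul_add {ψ χ χ' : (L2 Γ K →L[ℂ] L2 Γ K) → ℂ} (hψ : IsState ψ) (hχ : IsState χ)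
    (hχ' : IsState χ') (s t : ℝ) :
    average ψ (s • χ + t • χ') = s • average ψ χ + t • average ψ χ' := by
  ext T
  change ψ (mulOp K (fun h => orbitFun (s • χ + t • χ') T h)) =
    s • ψ (mulOp K (orbitFun χ T)) + t • ψ (mulOp K (orbitFun χ' T))
  rw [Complex.real_smul, Complex.real_smul, ← hψ.map_smul, ← hψ.map_smul, ← hψ.map_add,
    ← mulOp_smul _ (hχ.norm_orbitFun_le T), ← mulOp_smul _ (hχ'.norm_orbitFun_le T),
    ← mulOp_add (C := ‖(s : ℂ)‖ * ‖T‖) (C' := ‖(t : ℂ)‖ * ‖T‖)]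
  · rfl
  · intro h
    rw [norm_mul]
    exact mul_le_mul_of_nonneg_left (hχ.norm_orbitFun_le T h) (norm_nonneg _)
  · intro h
    rw [norm_mul]
    exact mul_le_mul_of_nonneg_left (hχ'.norm_orbitFun_le T h) (norm_nonneg _)

end Dynamics

/-! ### Minimal sets of states and extreme idempotents -/

section Minimality

open scoped ComplexOrder

variable {K : Type u} [NormedAddCommGroup K] [InnerProductSpace ℂ K]
variable {Γ : Type v} [Group Γ]

/-- A compact set of states that is stable under averages over `Γ` contains a minimal convex one. -/
theorem exists_minimal_averageStable {C : Set ((L2 Γ K →L[ℂ] L2 Γ K) → ℂ)} (hC : IsCompact C)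
    (hne : C.Nonempty) (hconv : Convex ℝ C) (hav : IsAverageStable C) :
    ∃ D ⊆ C, Minimal (fun D => D.Nonempty ∧ IsCompact D ∧ Convex ℝ D ∧ IsAverageStable D) D := by
  refine zorn_superset_nonempty
    {D | D.Nonempty ∧ IsCompact D ∧ Convex ℝ D ∧ IsAverageStable D} ?_ C ⟨hne, hC, hconv, hav⟩
  intro c hc hchain hcne
  refine ⟨⋂₀ c, ⟨?_, ?_, ?_, ?_⟩, fun s hs => Set.sInter_subset_of_mem hs⟩
  · have : Nonempty c := hcne.to_subtype
    refine IsCompact.nonempty_sInter_of_directed_nonempty_isCompact_isClosed ?_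
      (fun U hU => (hc hU).1) (fun U hU => (hc hU).2.1) (fun U hU => (hc hU).2.1.isClosed)
    intro a ha b hb
    rcases hchain.total ha hb with h | h
    · exact ⟨a, ha, subset_rfl, h⟩
    · exact ⟨b, hb, h, subset_rfl⟩
  · obtain ⟨s, hs⟩ := hcne
    exact (hc hs).2.1.of_isClosed_subset (isClosed_sInter fun t ht => (hc ht).2.1.isClosed)
      (Set.sInter_subset_of_mem hs)
  · exact convex_sInter fun s hs => (hc hs).2.2.1
  · exact fun ψ hψ χ hχ s hs => (hc hs).2.2.2 ψ hψ χ (hχ s hs)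

/-- Averaging against a fixed functional `φ`, as a linear map. -/
def averageRight (φ : (L2 Γ K →L[ℂ] L2 Γ K) → ℂ) :
    ((L2 Γ K →L[ℂ] L2 Γ K) → ℂ) →ₗ[ℝ] ((L2 Γ K →L[ℂ] L2 Γ K) → ℂ) where
  toFun ψ := average ψ φ
  map_add' _ _ := rfl
  map_smul' _ _ := rfl

theorem continuous_averageRight (φ : (L2 Γ K →L[ℂ] L2 Γ K) → ℂ) :
    Continuous (averageRight φ) :=
  continuous_pi fun _ => continuous_apply _

/-- A state `ε` of the kind produced by minimality: it is idempotent for averaging, and extreme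
among the averages of itself. -/
structure IsExtremeIdempotent (ε : (L2 Γ K →L[ℂ] L2 Γ K) → ℂ) : Prop where
  isState : IsState ε
  average_self : average ε ε = ε
  extreme : ∀ ψ ψ', IsState ψ → IsState ψ' → ∀ t : ℝ, 0 < t → t < 1 →
    t • average ψ ε + (1 - t) • average ψ' ε = ε → average ψ ε = ε

theorem IsExtremeIdempotent.apply_mulOp_orbitFun {ε : (L2 Γ K →L[ℂ] L2 Γ K) → ℂ}
    (hε : IsExtremeIdempotent ε) (T) :
    ε (mulOp K (orbitFun ε T)) = ε T :=
  congrFun hε.average_self T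

variable [CompleteSpace K]

/-- An extreme point `ε` of a minimal set is fixed by averaging against any element of it: the map
`ψ ↦ (ψ + average ψ φ) / 2` commutes with averaging, so by minimality it is onto. -/
theorem average_eq_self_of_mem_extremePoints {D : Set ((L2 Γ K →L[ℂ] L2 Γ K) → ℂ)}
    (hD : Minimal (fun D => D.Nonempty ∧ IsCompact D ∧ Convex ℝ D ∧ IsAverageStable D) D)
    (hDs : ∀ ψ ∈ D, IsState ψ) {ε φ : (L2 Γ K →L[ℂ] L2 Γ K) → ℂ} (hε : ε ∈ D.extremePoints ℝ)
    (hφ : φ ∈ D) : average ε φ = ε := by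
  obtain ⟨hne, hcomp, hconv, hav⟩ := hD.prop
  let F : ((L2 Γ K →L[ℂ] L2 Γ K) → ℂ) →ₗ[ℝ] ((L2 Γ K →L[ℂ] L2 Γ K) → ℂ) :=
    (1 / 2 : ℝ) • (LinearMap.id : _ →ₗ[ℝ] _) + (1 / 2 : ℝ) • averageRight φ
  have hF : ∀ ψ, F ψ = (1 / 2 : ℝ) • ψ + (1 / 2 : ℝ) • average ψ φ := fun ψ => rfl
  have hFc : Continuous F :=
    (continuous_id.const_smul (1 / 2 : ℝ)).add ((continuous_averageRight φ).const_smul (1 / 2 : ℝ))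
  have hsub : F '' D ⊆ D := by
    rintro _ ⟨ψ, hψ, rfl⟩
    rw [hF]
    exact hconv hψ (hav ψ (hDs ψ hψ) φ hφ) (by norm_num) (by norm_num) (by norm_num)
  have himage : D ⊆ F '' D := by
    refine hD.le_of_le ⟨hne.image _, hcomp.image hFc, hconv.linear_image F, ?_⟩ hsub
    rintro ψ' hψ' _ ⟨ψ, hψ, rfl⟩
    refine ⟨average ψ' ψ, hav ψ' hψ' ψ hψ, ?_⟩
    rw [hF, hF, average_smul_add hψ' (hDs ψ hψ) (hDs _ (hav ψ (hDs ψ hψ) φ hφ)),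
      average_average (hDs φ hφ)]
  obtain ⟨ψ, hψ, h⟩ := himage hε.1
  have h1 := hav ψ (hDs ψ hψ) φ hφ
  rw [mem_extremePoints] at hε
  obtain ⟨e1, e2⟩ := hε.2 ψ hψ _ h1
    ⟨1 / 2, 1 / 2, by norm_num, by norm_num, by norm_num, by rw [← hF, h]⟩
  rw [e1] at e2
  exact e2

theorem exists_isExtremeIdempotent {C : Set ((L2 Γ K →L[ℂ] L2 Γ K) → ℂ)} (hC : IsCompact C)
    (hne : C.Nonempty) (hconv : Convex ℝ C) (hav : IsAverageStable C)
    (hCs : ∀ ψ ∈ C, IsState ψ) : ∃ ε ∈ C, IsExtremeIdempotent ε := by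
  obtain ⟨D, hDC, hD⟩ := exists_minimal_averageStable hC hne hconv hav
  have hDs : ∀ ψ ∈ D, IsState ψ := fun ψ hψ => hCs ψ (hDC hψ)
  obtain ⟨ε, hε⟩ := hD.prop.2.1.extremePoints_nonempty hD.prop.1
  refine ⟨ε, hDC hε.1, hDs ε hε.1, average_eq_self_of_mem_extremePoints hD hDs hε hε.1, ?_⟩
  intro ψ ψ' hψ hψ' t ht0 ht1 h
  have hav' := hD.prop.2.2.2
  exact ((mem_extremePoints.1 hε).2 _ (hav' ψ hψ ε hε.1) _ (hav' ψ' hψ' ε hε.1)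
    ⟨t, 1 - t, ht0, by linarith, by ring, h⟩).1

namespace IsExtremeIdempotent

variable {ε : (L2 Γ K →L[ℂ] L2 Γ K) → ℂ}

/-- Extremality forces `ε` to be multiplicative on orbit functions: splitting `ε` by means of the
densities `1/2 ± c f` gives two averages of `ε` with `ε` as a convex combination. -/
theorem apply_mulOp_sq (hε : IsExtremeIdempotent ε) {T : L2 Γ K →L[ℂ] L2 Γ K} (hT : star T = T) :
    ε (mulOp K (orbitFun ε T) * mulOp K (orbitFun ε T)) = ε T * ε T := by
  have hs := hε.isState
  have hreal : ∀ S : L2 Γ K →L[ℂ] L2 Γ K, star S = S → ((ε S).re : ℂ) = ε S := fun S hS => by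
    have := hs.map_star S
    rw [hS] at this
    exact Complex.conj_eq_iff_re.1 this.symm
  set f := orbitFun ε T with hf
  obtain ⟨r, hr⟩ : ∃ r : Γ → ℝ, ∀ h, f h = (r h : ℂ) :=
    ⟨fun h => (f h).re, fun h => (hreal _ (by rw [star_conjTranslation, hT])).symm⟩
  obtain ⟨t0, ht0⟩ : ∃ t0 : ℝ, ε T = (t0 : ℂ) := ⟨_, (hreal T hT).symm⟩
  have hrT : ∀ h, |r h| ≤ ‖T‖ := fun h => by
    have := hs.norm_orbitFun_le T h
    rwa [← hf, hr, Complex.norm_real] at this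
  have htT : |t0| ≤ ‖T‖ := by
    have := hs.norm_le T
    rwa [ht0, Complex.norm_real] at this
  have hfC : ∀ h, ‖f h‖ ≤ ‖T‖ := hs.norm_orbitFun_le T
  obtain ⟨c, hc0, hcT⟩ : ∃ c : ℝ, 0 < c ∧ c * ‖T‖ ≤ 1 / 4 := by
    refine ⟨1 / (4 * (‖T‖ + 1)), by positivity, ?_⟩
    rw [div_mul_eq_mul_div, div_le_div_iff₀ (by positivity) (by norm_num)]
    linarith [norm_nonneg T]
  have hbound : ∀ s : ℝ, |s| ≤ ‖T‖ → |c * s| ≤ 1 / 4 := fun s h => by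
    rw [abs_mul, abs_of_pos hc0]
    exact (mul_le_mul_of_nonneg_left h hc0.le).trans hcT
  -- The two densities and the corresponding compressions of `ε`.
  have main : ∀ d : ℝ, |d| = c → ∃ ψ, IsState ψ ∧ ∀ f' : Γ → ℂ, (∃ C, ∀ h, ‖f' h‖ ≤ C) →
      ((1 / 2 + d * t0 : ℝ) : ℂ) * ψ (mulOp K f') =
        1 / 2 * ε (mulOp K f') + d * ε (mulOp K fun h => f h * f' h) := by
    intro d hd
    have hdb : ∀ s : ℝ, |s| ≤ ‖T‖ → 1 / 4 ≤ 1 / 2 + d * s ∧ 1 / 2 + d * s ≤ 3 / 4 := fun s h => by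
      have h1 : |d * s| ≤ 1 / 4 := by
        have := hbound s h
        rwa [abs_mul, abs_of_pos hc0, ← hd, ← abs_mul] at this
      obtain ⟨h2, h3⟩ := abs_le.1 h1
      constructor <;> linarith
    let w : Γ → ℂ := fun h => ((√(1 / 2 + d * r h) : ℝ) : ℂ)
    have hw1 : ∀ h, ‖w h‖ ≤ 1 := fun h => by
      change ‖((√(1 / 2 + d * r h) : ℝ) : ℂ)‖ ≤ 1
      rw [Complex.norm_real, Real.norm_eq_abs, abs_of_nonneg (Real.sqrt_nonneg _)]
      exact Real.sqrt_le_one.2 (by linarith [(hdb _ (hrT h)).2])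
    have hww : ∀ h, w h * w h = 1 / 2 + d * f h := fun h => by
      change ((√(1 / 2 + d * r h) : ℝ) : ℂ) * ((√(1 / 2 + d * r h) : ℝ) : ℂ) = _
      rw [← Complex.ofReal_mul, Real.mul_self_sqrt (by linarith [(hdb _ (hrT h)).1]), hr]
      push_cast
      ring
    have hwstar : star (mulOp K w) = mulOp K w := by
      rw [star_mulOp hw1]
      congr 1
      ext h
      exact Complex.conj_ofReal _
    have hsplit : ∀ f' : Γ → ℂ, (∃ C, ∀ h, ‖f' h‖ ≤ C) →
        ε (star (mulOp K w) * mulOp K f' * mulOp K w) =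
          1 / 2 * ε (mulOp K f') + d * ε (mulOp K fun h => f h * f' h) := by
      rintro f' ⟨C, hC⟩
      have hC2 : ∀ h, ‖f h * f' h‖ ≤ ‖T‖ * C := fun h => by
        rw [norm_mul]
        exact mul_le_mul (hfC h) (hC h) (norm_nonneg _) (norm_nonneg _)
      have hwf : ∀ h, ‖w h * f' h‖ ≤ 1 * C := fun h => by
        rw [norm_mul]
        exact mul_le_mul (hw1 h) (hC h) (norm_nonneg _) zero_le_one
      rw [hwstar, ← mulOp_mul hw1 hC, ← mulOp_mul hwf hw1]
      have : (fun h => w h * f' h * w h) = fun h => 1 / 2 * f' h + d * (f h * f' h) := by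
        ext h
        rw [mul_right_comm, hww]
        ring
      rw [this, mulOp_add (C := ‖(1 / 2 : ℂ)‖ * C) (C' := ‖(d : ℂ)‖ * (‖T‖ * C)), hs.map_add,
        mulOp_smul _ hC, mulOp_smul _ hC2, hs.map_smul, hs.map_smul]
      · intro h
        rw [norm_mul]
        exact mul_le_mul_of_nonneg_left (hC h) (norm_nonneg _)
      · intro h
        rw [norm_mul]
        exact mul_le_mul_of_nonneg_left (hC2 h) (norm_nonneg _)
    have hmass : ε (star (mulOp K w) * mulOp K w) = ((1 / 2 + d * t0 : ℝ) : ℂ) := by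
      have h1 := hsplit (fun _ => 1) ⟨1, fun _ => by simp⟩
      simp only [mul_one, mulOp_const, one_smul, hs.map_one] at h1
      rw [h1, show (fun h => f h) = f from rfl, hf, hε.apply_mulOp_orbitFun, ht0]
      push_cast
      ring
    have hne : ((1 / 2 + d * t0 : ℝ) : ℂ) ≠ 0 := by
      have := (hdb t0 htT).1
      exact_mod_cast (by linarith : (0 : ℝ) < 1 / 2 + d * t0).ne'
    refine ⟨_, hs.compress (mulOp K w) (by rw [hmass]; exact hne), fun f' hf' => ?_⟩
    rw [hmass, mul_div_cancel₀ _ hne, hsplit f' hf']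
  obtain ⟨ψ, hψ, h1⟩ := main c (abs_of_pos hc0)
  obtain ⟨ψ', hψ', h2⟩ := main (-c) (by rw [abs_neg, abs_of_pos hc0])
  have hct := abs_le.1 (hbound t0 htT)
  have key := hε.extreme ψ ψ' hψ hψ' (1 / 2 + c * t0) (by linarith [hct.1])
    (by linarith [hct.2]) (by
    ext S
    change (1 / 2 + c * t0) • ψ (mulOp K (orbitFun ε S)) +
      (1 - (1 / 2 + c * t0)) • ψ' (mulOp K (orbitFun ε S)) = ε S
    have hS := hs.norm_orbitFun_le S
    rw [Complex.real_smul, Complex.real_smul, h1 _ ⟨_, hS⟩,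
      show 1 - (1 / 2 + c * t0) = 1 / 2 + -c * t0 by ring, h2 _ ⟨_, hS⟩, hε.apply_mulOp_orbitFun]
    push_cast
    ring)
  have h3 := h1 f ⟨_, hfC⟩
  have h4 : ψ (mulOp K f) = ε T := congrFun key T
  rw [h4, mulOp_mul hfC hfC, hf, hε.apply_mulOp_orbitFun, ht0] at h3
  rw [← hf] at h3
  rw [ht0]
  have hc' : (c : ℂ) ≠ 0 := by exact_mod_cast hc0.ne'
  refine mul_left_cancel₀ hc' ?_
  push_cast at h3
  linear_combination -h3

/-- Orbit functions of self-adjoint operators lie in the multiplicative domain of `ε`. -/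
theorem apply_mul_mulOp (hε : IsExtremeIdempotent ε) {T : L2 Γ K →L[ℂ] L2 Γ K} (hT : star T = T)
    (Y : L2 Γ K →L[ℂ] L2 Γ K) :
    ε (Y * mulOp K (orbitFun ε T)) = ε Y * ε T ∧ ε (mulOp K (orbitFun ε T) * Y) = ε Y * ε T := by
  have hs := hε.isState
  have hreal : star (ε T) = ε T := by rw [← hs.map_star, hT]
  have hFs : star (mulOp K (orbitFun ε T)) = mulOp K (orbitFun ε T) := by
    rw [star_mulOp (hs.norm_orbitFun_le T)]
    congr 1
    ext h
    rw [orbitFun, ← hs.map_star, star_conjTranslation, hT]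
  set F := mulOp K (orbitFun ε T) with hF
  have hFε : ε F = ε T := hε.apply_mulOp_orbitFun T
  have hDs : star (F - ε T • 1) = F - ε T • 1 := by
    rw [star_sub, hFs, star_smul, star_one, hreal]
  have hD : ε (star (F - ε T • 1) * (F - ε T • 1)) = 0 := by
    rw [hDs, sub_mul, mul_sub, mul_smul_comm, smul_mul_assoc, mul_one, one_mul, hs.map_sub,
      hs.map_sub, hs.map_smul, hs.map_smul, hs.map_sub, hs.map_smul, hs.map_one,
      hε.apply_mulOp_sq hT, hFε]
    ring
  have h1 : ∀ Y, ε (Y * (F - ε T • 1)) = 0 := fun Y => by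
    have := hs.map_star_mul_eq_zero hD (star Y)
    rwa [star_star] at this
  have h2 : ∀ Y, ε ((F - ε T • 1) * Y) = 0 := fun Y => by
    have h3 := h1 (star Y)
    have h4 := hs.map_star (star Y * (F - ε T • 1))
    rwa [h3, star_zero, star_mul, star_star, hDs] at h4
  constructor
  · have := h1 Y
    rw [mul_sub, hs.map_sub, mul_smul_comm, mul_one, hs.map_smul, sub_eq_zero] at this
    rw [this, mul_comm]
  · have := h2 Y
    rw [sub_mul, hs.map_sub, smul_mul_assoc, one_mul, hs.map_smul, sub_eq_zero] at this
    rw [this, mul_comm]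

end IsExtremeIdempotent

end Minimality

/-! ### Amenable invariant subalgebras and the amenable radical -/

section Radical

open scoped ComplexOrder
open TracialVonNeumannAlgebra

variable {K : Type u} [NormedAddCommGroup K] [InnerProductSpace ℂ K] [CompleteSpace K]
variable {Γ : Type v} [Group Γ]
variable {A : TracialVonNeumannAlgebra K} {σ : Γ →* (A.Elem ≃⋆ₐ[ℂ] A.Elem)}

/-- The `N`-central states on `B(ℓ²(Γ, L²(A)))` that extend the trace of the crossed product. -/
def centralStates (A : TracialVonNeumannAlgebra K) (σ : Γ →* (A.Elem ≃⋆ₐ[ℂ] A.Elem))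
    (N : VonNeumannAlgebra (L2 Γ K)) : Set ((L2 Γ K →L[ℂ] L2 Γ K) → ℂ) :=
  {φ | IsState φ ∧ (∀ x ∈ N, ∀ T, φ (x * T) = φ (T * x)) ∧
    ∀ m ∈ crossedProduct A σ ⊤, φ m = ⟪crossedVac Γ A, m (crossedVac Γ A)⟫_ℂ}

theorem isCompact_centralStates (N : VonNeumannAlgebra (L2 Γ K)) :
    IsCompact (centralStates A σ N) := by
  have : centralStates A σ N = {φ | IsState φ} ∩
      ((⋂ x ∈ N, ⋂ T, {φ | φ (x * T) = φ (T * x)}) ∩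
      ⋂ m ∈ crossedProduct A σ ⊤, {φ | φ m = ⟪crossedVac Γ A, m (crossedVac Γ A)⟫_ℂ}) := by
    ext φ
    simp only [centralStates, Set.mem_inter_iff, Set.mem_iInter, Set.mem_ofPred_eq]
  rw [this]
  refine isCompact_setOf_isState.inter_right (IsClosed.inter ?_ ?_)
  · exact isClosed_biInter fun x _ => isClosed_iInter fun T =>
      isClosed_eq (continuous_apply _) (continuous_apply _)
  · exact isClosed_biInter fun m _ => isClosed_eq (continuous_apply _) continuous_const

theorem convex_centralStates (N : VonNeumannAlgebra (L2 Γ K)) :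
    Convex ℝ (centralStates A σ N) := by
  rintro φ ⟨h1, h2, h3⟩ ψ ⟨k1, k2, k3⟩ s t hs ht hst
  have hst' : (s : ℂ) + t = 1 := by exact_mod_cast hst
  have happ : ∀ T, (s • φ + t • ψ) T = s * φ T + t * ψ T := fun T => rfl
  refine ⟨⟨?_, ?_, ?_, ?_⟩, ?_, ?_⟩
  · intro S T
    rw [happ, happ, happ, h1.map_add, k1.map_add]; ring
  · intro c T
    rw [happ, happ, h1.map_smul, k1.map_smul]; ring
  · intro T hT
    rw [happ]
    exact add_nonneg (mul_nonneg (Complex.zero_le_real.2 hs) (h1.map_nonneg T hT))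
      (mul_nonneg (Complex.zero_le_real.2 ht) (k1.map_nonneg T hT))
  · rw [happ, h1.map_one, k1.map_one, mul_one, mul_one, hst']
  · intro x hx T
    rw [happ, happ, h2 x hx, k2 x hx]
  · intro m hm
    rw [happ, h3 m hm, k3 m hm, ← add_mul, hst', one_mul]

theorem IsConjInvariant.conjTranslation_mem {N : VonNeumannAlgebra (L2 Γ K)}
    (hN : IsConjInvariant N) (g : Γ) {x : L2 Γ K →L[ℂ] L2 Γ K} (hx : x ∈ N) :
    conjTranslation g x ∈ N := by
  have := hN g⁻¹ x hx
  rwa [star_leftTranslation, inv_inv] at this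

theorem inner_crossedVac_conjTranslation (hσ : ∀ g a, A.trace (σ g a) = A.trace a) (g : Γ)
    {m : L2 Γ K →L[ℂ] L2 Γ K} (hm : m ∈ crossedProduct A σ ⊤) :
    ⟪crossedVac Γ A, conjTranslation g m (crossedVac Γ A)⟫_ℂ =
      ⟪crossedVac Γ A, m (crossedVac Γ A)⟫_ℂ := by
  have hl : ∀ k : Γ, leftTranslation K k ∈ crossedProduct A σ ⊤ := fun k =>
    leftTranslation_mem_crossedProduct σ (Subgroup.mem_top k)
  rw [conjTranslation, mul_assoc, isTraceVector_crossedVac hσ _ (hl _) _ (mul_mem hm (hl _)),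
    mul_assoc, leftTranslation_mul_inv, mul_one]

theorem isAverageStable_centralStates (hσ : ∀ g a, A.trace (σ g a) = A.trace a)
    {N : VonNeumannAlgebra (L2 Γ K)} (hN : IsConjInvariant N) :
    IsAverageStable (centralStates A σ N) := by
  rintro ψ hψ χ ⟨h1, h2, h3⟩
  refine ⟨hψ.average h1, fun x hx T => ?_, fun m hm => ?_⟩
  · rw [average, average]
    congr 2
    ext h
    rw [orbitFun, orbitFun, conjTranslation_mul, conjTranslation_mul,
      h2 _ (hN.conjTranslation_mem h hx)]
  · have h4 : orbitFun χ m = fun _ => ⟪crossedVac Γ A, m (crossedVac Γ A)⟫_ℂ := by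
      ext h
      have hl : ∀ k : Γ, leftTranslation K k ∈ crossedProduct A σ ⊤ := fun k =>
        leftTranslation_mem_crossedProduct σ (Subgroup.mem_top k)
      have hm' : conjTranslation h m ∈ crossedProduct A σ ⊤ := mul_mem (mul_mem (hl _) hm) (hl _)
      rw [orbitFun, h3 _ hm', inner_crossedVac_conjTranslation hσ h hm]
    rw [average, h4, mulOp_const, hψ.map_smul, hψ.map_one, mul_one]

/-- A subgroup fixing a state is amenable: the state restricts to an invariant mean on `ℓ^∞(Γ)`,
and `ℓ^∞(L)` embeds equivariantly into `ℓ^∞(Γ)` by a choice of coset representatives. -/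
theorem isAmenableGroup_of_le_stateStabilizer {ε : (L2 Γ K →L[ℂ] L2 Γ K) → ℂ} (hε : IsState ε)
    {L : Subgroup Γ} (hL : L ≤ stateStabilizer ε) : IsAmenableGroup L := by
  classical
  -- `r h` is the `L`-component of `h` with respect to right coset representatives.
  have hmem : ∀ h : Γ, h * ((h⁻¹ : Γ) : Γ ⧸ L).out ∈ L := fun h => by
    have h1 : ((h⁻¹ : Γ) : Γ ⧸ L) = (((h⁻¹ : Γ) : Γ ⧸ L).out : Γ ⧸ L) :=
      (QuotientGroup.out_eq' _).symm
    have h2 := QuotientGroup.eq.1 h1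
    rwa [inv_inv] at h2
  let r : Γ → L := fun h => ⟨h * ((h⁻¹ : Γ) : Γ ⧸ L).out, hmem h⟩
  have hr : ∀ (l : L) (h : Γ), r (l * h) = l * r h := fun l h => by
    apply Subtype.ext
    change ((l : Γ) * h) * (((l * h : Γ)⁻¹ : Γ) : Γ ⧸ L).out =
      l * (h * ((h⁻¹ : Γ) : Γ ⧸ L).out)
    have h1 : (((l * h : Γ)⁻¹ : Γ) : Γ ⧸ L) = ((h⁻¹ : Γ) : Γ ⧸ L) := by
      rw [QuotientGroup.eq, inv_inv, mul_assoc, mul_inv_cancel, mul_one]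
      exact l.2
    rw [h1, mul_assoc]
  obtain ⟨χ, hχd⟩ : ∃ χ : Set L → Γ → ℂ, ∀ s h, χ s h = if r h ∈ s then 1 else 0 :=
    ⟨_, fun _ _ => rfl⟩
  have hχ : ∀ s h, ‖χ s h‖ ≤ 1 := fun s h => by
    rw [hχd]
    split_ifs <;> simp
  refine ⟨fun s => (ε (mulOp K (χ s))).re, fun s => ?_, ?_, fun s t hst => ?_, fun l s => ?_⟩
  · refine (Complex.nonneg_iff.1 (hε.map_nonneg _ (isPositive_mulOp (hχ s) fun h => ?_))).1
    rw [hχd]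
    split_ifs
    · exact zero_le_one
    · exact le_rfl
  · have : χ Set.univ = fun _ => 1 := funext fun h => by
      rw [hχd, if_pos (Set.mem_univ _)]
    change (ε (mulOp K (χ Set.univ))).re = 1
    rw [this, mulOp_const, one_smul, hε.map_one, Complex.one_re]
  · have : χ (s ∪ t) = fun h => χ s h + χ t h := by
      ext h
      rw [hχd, hχd, hχd]
      by_cases h1 : r h ∈ s
      · have h2 : r h ∉ t := fun h2 => Set.disjoint_left.1 hst h1 h2
        simp [h1, h2]
      · by_cases h2 : r h ∈ t <;> simp [h1, h2]
    change (ε (mulOp K (χ (s ∪ t)))).re = _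
    rw [this, mulOp_add (hχ s) (hχ t), hε.map_add, Complex.add_re]
  · have h1 : ∀ h, χ ((fun x => l * x) '' s) (l * h) = χ s h := fun h => by
      rw [hχd, hχd, hr]
      congr 1
      simp
    change (ε (mulOp K (χ ((fun x => l * x) '' s)))).re = _
    rw [← mem_stateStabilizer.1 (hL l.2), conjTranslation_mulOp _ (hχ _), funext h1]

theorem normalCore_stateStabilizer_le_amenableRadical {ε : (L2 Γ K →L[ℂ] L2 Γ K) → ℂ}
    (hε : IsState ε) : (stateStabilizer ε).normalCore ≤ amenableRadical Γ :=
  le_sSup ⟨(stateStabilizer ε).normalCore_normal,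
    isAmenableGroup_of_le_stateStabilizer hε (Subgroup.normalCore_le _)⟩

theorem crossedRep_comm_mulOp (a : A.Elem) {f : Γ → ℂ} {C : ℝ} (hf : ∀ h, ‖f h‖ ≤ C) :
    crossedRep A σ a * mulOp K f = mulOp K f * crossedRep A σ a := by
  ext ξ h
  rw [mul_apply_eq_comp, mul_apply_eq_comp, crossedRep_apply, mulOp_apply hf, mulOp_apply hf,
    crossedRep_apply, map_smul]

/-- The mechanism of the proof. Moving `f = f_T` around the central state `ε` in
`ε(x λ_g* π(a) f) = ε(λ_g* π(a) f x)` multiplies `ε(x λ_g* π(a))` by `ε(T)` on one side and by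
`ε(λ_g* T λ_g)` on the other, so it vanishes if `g` moves `ε`. -/
theorem inner_crossedVac_eq_zero {N : VonNeumannAlgebra (L2 Γ K)} (hNM : N ≤ crossedProduct A σ ⊤)
    {ε : (L2 Γ K →L[ℂ] L2 Γ K) → ℂ} (hεc : ε ∈ centralStates A σ N) (hε : IsExtremeIdempotent ε)
    {g : Γ} (hg : g ∉ stateStabilizer ε) {x : L2 Γ K →L[ℂ] L2 Γ K} (hx : x ∈ N) (a : A.Elem) :
    ⟪crossedVac Γ A, (x * (leftTranslation K g⁻¹ * crossedRep A σ a)) (crossedVac Γ A)⟫_ℂ = 0 := by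
  have hs := hε.isState
  obtain ⟨-, hcent, htr⟩ := hεc
  have hl : ∀ k : Γ, leftTranslation K k ∈ crossedProduct A σ ⊤ := fun k =>
    leftTranslation_mem_crossedProduct σ (Subgroup.mem_top k)
  set S := leftTranslation K g⁻¹ * crossedRep A σ a with hS
  have hSM : S ∈ crossedProduct A σ ⊤ := mul_mem (hl _) (crossedRep_mem_crossedProduct σ ⊤ a)
  rw [← htr _ (mul_mem (hNM hx) hSM)]
  by_contra hne
  refine hg (mem_stateStabilizer.2 ?_)
  have key : ∀ T : L2 Γ K →L[ℂ] L2 Γ K, star T = T → ε (conjTranslation g T) = ε T := by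
    intro T hT
    have hfC := hs.norm_orbitFun_le T
    have h1 : ε (x * S * mulOp K (orbitFun ε T)) = ε (x * S) * ε T := (hε.apply_mul_mulOp hT _).1
    have h2 : S * mulOp K (orbitFun ε T) = mulOp K (orbitFun ε (conjTranslation g T)) * S := by
      have h3 : orbitFun ε (conjTranslation g T) = fun h => orbitFun ε T (g * h) := by
        ext h
        rw [orbitFun, orbitFun, conjTranslation_conjTranslation]
      rw [h3, ← conjTranslation_mulOp g hfC, hS, mul_assoc, crossedRep_comm_mulOp a hfC,
        conjTranslation]
      simp only [← mul_assoc]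
      rw [mul_assoc (leftTranslation K g⁻¹ * _), leftTranslation_mul_inv, mul_one]
    have h4 : star (conjTranslation g T) = conjTranslation g T := by
      rw [star_conjTranslation, hT]
    rw [mul_assoc, hcent x hx, h2, mul_assoc, (hε.apply_mul_mulOp h4 _).2, ← hcent x hx] at h1
    exact mul_left_cancel₀ hne h1
  intro T
  rw [← realPart_add_I_smul_imaginaryPart T, conjTranslation_add, conjTranslation_smul, hs.map_add,
    hs.map_add, hs.map_smul, hs.map_smul, key _ (realPart T).2.star_eq,
    key _ (imaginaryPart T).2.star_eq]

theorem entry_eq_zero_of_notMem_stateStabilizer (hσ : ∀ g a, A.trace (σ g a) = A.trace a)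
    {N : VonNeumannAlgebra (L2 Γ K)} (hNM : N ≤ crossedProduct A σ ⊤)
    {ε : (L2 Γ K →L[ℂ] L2 Γ K) → ℂ} (hεc : ε ∈ centralStates A σ N) (hε : IsExtremeIdempotent ε)
    {g : Γ} (hg : g ∉ stateStabilizer ε) {x : L2 Γ K →L[ℂ] L2 Γ K} (hx : x ∈ N) (k : Γ) :
    entry x (g * k) k = 0 := by
  classical
  have h1 : coeff (hNM hx) 1 g⁻¹ = 0 := by
    have h2 := inner_crossedVac_eq_zero hNM hεc hε hg hx (star (coeff (hNM hx) 1 g⁻¹))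
    rw [crossedVac_eq, lp.inner_single_left, mul_apply_eq_comp, mul_apply_eq_comp,
      crossedRep_single, leftTranslation_single, inv_one, action_one, mul_one, ← entry_apply,
      ← coe_coeff (hNM hx)] at h2
    refine A.trace_faithful _ ?_
    rw [A.trace_mul_comm]
    exact h2
  have h4 : coeff (hNM hx) (g * k) k = 0 := by
    rw [coeff_eq hσ, mul_inv_cancel_right]
    have h5 := action_coeff hσ (hNM hx) 1 g⁻¹ g
    rw [h1, one_mul, inv_mul_cancel] at h5
    rw [(σ g).injective (h5.trans (map_zero (σ g)).symm), map_zero]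
  rw [← coe_coeff (hNM hx), h4]
  rfl

/-- An amenable invariant subalgebra lies in the crossed product by the amenable radical. -/
theorem IsInvariantAmenableSubalgebra.le_crossedProduct_amenableRadical [Countable Γ]
    [TopologicalSpace.SeparableSpace K] (hσ : ∀ g a, A.trace (σ g a) = A.trace a)
    {N : VonNeumannAlgebra (L2 Γ K)} (hN : IsInvariantAmenableSubalgebra A σ N) :
    N ≤ crossedProduct A σ (amenableRadical Γ) := by
  obtain ⟨hNM, hinv, hamen⟩ := hN
  obtain ⟨S, hS, htot⟩ := exists_total_commutant (Γ := Γ) hσ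
  have hne : (centralStates A σ N).Nonempty :=
    exists_hypertrace hNM norm_crossedVac (isTraceVector_crossedVac hσ) hamen S hS htot
  obtain ⟨ε, hεc, hε⟩ := exists_isExtremeIdempotent (isCompact_centralStates N) hne
    (convex_centralStates N) (isAverageStable_centralStates hσ hinv) fun ψ hψ => hψ.1
  intro x hx
  refine mem_crossedProduct_of_entry_eq_zero hσ (hNM hx) fun h k hhk => ?_
  have h1 : h * k⁻¹ ∉ (stateStabilizer ε).normalCore := fun h2 =>
    hhk (normalCore_stateStabilizer_le_amenableRadical hε.isState h2)
  obtain ⟨c, hc⟩ : ∃ c, c * (h * k⁻¹) * c⁻¹ ∉ stateStabilizer ε := by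
    by_contra! h2
    exact h1 h2
  have h3 := entry_eq_zero_of_notMem_stateStabilizer hσ hNM hεc hε hc
    (hinv.conjTranslation_mem c⁻¹ hx) (c * k)
  rw [entry_conjTranslation] at h3
  convert h3 using 2 <;> group

end Radical

/-! ### The crossed product by the trivial subgroup -/

section TrivialSubgroup

open TracialVonNeumannAlgebra

variable {K : Type u} [NormedAddCommGroup K] [InnerProductSpace ℂ K] [CompleteSpace K]
variable {Γ : Type v} [Group Γ]
variable {A : TracialVonNeumannAlgebra K} {σ : Γ →* (A.Elem ≃⋆ₐ[ℂ] A.Elem)}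

/-- Elements of the crossed product by the trivial subgroup are diagonal, because the
projections onto the coordinates lie in the commutant of `π(A)`. -/
theorem entry_eq_zero_of_mem_crossedProduct_bot {x : L2 Γ K →L[ℂ] L2 Γ K}
    (hx : x ∈ crossedProduct A σ ⊥) {h k : Γ} (hne : h ≠ k) : entry x h k = 0 := by
  classical
  obtain ⟨p, hp⟩ : ∃ p : L2 Γ K →L[ℂ] L2 Γ K, ∀ ξ, p ξ = lp.single 2 k (ξ k) :=
    ⟨lp.singleContinuousLinearMap ℂ (fun _ : Γ => K) 2 k ∘L lp.evalCLM ℂ (fun _ : Γ => K) 2 k,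
      fun ξ => rfl⟩
  have h1 : p * x = x * p := by
    refine (mem_crossedProduct_iff σ).1 hx p (fun a => ?_) fun g hg => ?_
    · ext ξ : 1
      rw [mul_apply_eq_comp, mul_apply_eq_comp, hp, hp, crossedRep_single, crossedRep_apply_inv]
    · rw [Subgroup.mem_bot.1 hg, leftTranslation_one, one_mul, mul_one]
  ext ξ
  have h2 := congrArg (fun v : L2 Γ K => v h) (DFunLike.congr_fun h1 (lp.single 2 k ξ))
  simp only [mul_apply_eq_comp, hp, lp.single_apply_self] at h2
  rw [lp.single_apply_ne _ _ _ hne, ← entry_apply] at h2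
  rw [← h2]
  rfl

theorem entry_crossedRep_of_ne (a : A.Elem) {h k : Γ} (hne : h ≠ k) :
    entry (crossedRep A σ a) h k = 0 :=
  entry_eq_zero_of_mem_crossedProduct_bot (crossedRep_mem_crossedProduct σ ⊥ a) hne

/-- The crossed product by the trivial subgroup is `π(A)`; in particular `π(A)` is a von Neumann
algebra. -/
theorem coe_crossedProduct_bot (hσ : ∀ g a, A.trace (σ g a) = A.trace a) :
    (crossedProduct A σ ⊥ : Set (L2 Γ K →L[ℂ] L2 Γ K)) = Set.range (crossedRep A σ) := by
  ext x
  constructor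
  · intro hx
    have hx' : x ∈ crossedProduct A σ ⊤ := crossedProduct_mono σ bot_le hx
    refine ⟨coeff hx' 1 1, ext_entry fun h k => ?_⟩
    rcases eq_or_ne h k with rfl | hne
    · rw [entry_crossedRep_self, ← coe_coeff hx' h h, coeff_eq hσ hx' h h, mul_inv_cancel]
    · rw [entry_crossedRep_of_ne _ hne, entry_eq_zero_of_mem_crossedProduct_bot hx hne]
  · rintro ⟨a, rfl⟩
    exact crossedRep_mem_crossedProduct σ ⊥ a

theorem isConjInvariant_crossedProduct_bot (hσ : ∀ g a, A.trace (σ g a) = A.trace a) :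
    IsConjInvariant (crossedProduct A σ (⊥ : Subgroup Γ)) := by
  intro g x hx
  rw [← SetLike.mem_coe, coe_crossedProduct_bot hσ] at hx ⊢
  obtain ⟨a, rfl⟩ := hx
  refine ⟨σ g a, ?_⟩
  rw [leftTranslation_mul_crossedRep, star_leftTranslation, mul_assoc, leftTranslation_mul_inv,
    mul_one]

theorem entry_crossedRep_mul (a b : A.Elem) (T : L2 Γ K →L[ℂ] L2 Γ K) :
    entry (crossedRep A σ a * T * crossedRep A σ b) 1 1 =
      (a : K →L[ℂ] K) * entry T 1 1 * (b : K →L[ℂ] K) := by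
  classical
  ext ξ
  rw [entry_apply, mul_apply_eq_comp, mul_apply_eq_comp, crossedRep_single, crossedRep_apply_inv,
    inv_one, action_one, action_one, mul_apply_eq_comp, mul_apply_eq_comp, entry_apply]

theorem isPositive_crossedRep {a : A.Elem} (ha : (a : K →L[ℂ] K).IsPositive) :
    (crossedRep A σ a).IsPositive := by
  -- The positive square root of `a` commutes with the commutant of `A`, so it lies in `A`.
  have h0 : (0 : K →L[ℂ] K) ≤ a := (ContinuousLinearMap.nonneg_iff_isPositive _).2 ha
  have hmem : CFC.sqrt (a : K →L[ℂ] K) ∈ A.alg := by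
    refine (SetLike.ext_iff.1 A.alg.commutant_commutant _).1
      (VonNeumannAlgebra.mem_commutant_iff.2 fun T hT => ?_)
    have h1 : Commute (a : K →L[ℂ] K) T := VonNeumannAlgebra.mem_commutant_iff.1 hT _ a.2
    exact (h1.cfcₙ_nnreal NNReal.sqrt).symm
  have hsa : star (CFC.sqrt (a : K →L[ℂ] K)) = CFC.sqrt (a : K →L[ℂ] K) :=
    (IsSelfAdjoint.of_nonneg (CFC.sqrt_nonneg (a : K →L[ℂ] K))).star_eq
  let b : A.Elem := ⟨CFC.sqrt (a : K →L[ℂ] K), hmem⟩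
  have hb : star b * b = a := by
    apply Subtype.ext
    change star (CFC.sqrt (a : K →L[ℂ] K)) * CFC.sqrt (a : K →L[ℂ] K) = a
    rw [hsa, CFC.sqrt_mul_sqrt_self _ h0]
  rw [← hb, crossedRep_mul, ← star_crossedRep, ← ContinuousLinearMap.nonneg_iff_isPositive]
  exact star_mul_self_nonneg _

/-- Amenability passes from `A` to `π(A)`: compress to the coordinate at the identity, apply the
expectation onto `A`, and embed by `π`. -/
theorem isAmenable_crossedProduct_bot (hσ : ∀ g a, A.trace (σ g a) = A.trace a)
    (hA : A.alg.IsAmenable) : (crossedProduct A σ (⊥ : Subgroup Γ)).IsAmenable := by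
  obtain ⟨E, hE⟩ := hA
  have hmem : ∀ x, x ∈ crossedProduct A σ (⊥ : Subgroup Γ) ↔ ∃ a, crossedRep A σ a = x :=
    fun x => by
    rw [← SetLike.mem_coe, coe_crossedProduct_bot hσ]; rfl
  let e : (L2 Γ K →L[ℂ] L2 Γ K) → A.Elem := fun T => ⟨E (entry T 1 1), hE.map_mem _⟩
  have hadd : ∀ a b : A.Elem, crossedRep A σ (a + b) = crossedRep A σ a + crossedRep A σ b :=
    fun a b => by
      ext ξ h
      rw [crossedRep_apply, map_add]; rfl
  have hsmul : ∀ (c : ℂ) (a : A.Elem), crossedRep A σ (c • a) = c • crossedRep A σ a :=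
    fun c a => by
      ext ξ h
      rw [crossedRep_apply, map_smul]; rfl
  have he : ∀ a b T, e (crossedRep A σ a * T * crossedRep A σ b) = a * e T * b := fun a b T => by
    apply Subtype.ext
    change E _ = (a : K →L[ℂ] K) * E _ * (b : K →L[ℂ] K)
    rw [entry_crossedRep_mul, hE.map_bimodule _ a.2 _ b.2]
  refine ⟨{ toFun := fun T => crossedRep A σ (e T), map_add' := ?_, map_smul' := ?_ },
    ?_, ?_, ?_, ?_⟩
  · intro S T
    rw [← hadd]
    congr 1
    apply Subtype.ext
    change E (entry S 1 1 + entry T 1 1) = _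
    rw [map_add]
    rfl
  · intro c T
    rw [RingHom.id_apply, ← hsmul]
    congr 1
    apply Subtype.ext
    change E (c • entry T 1 1) = _
    rw [map_smul]
    rfl
  · exact fun T => crossedRep_mem_crossedProduct σ ⊥ _
  · intro T hT
    obtain ⟨a, rfl⟩ := (hmem T).1 hT
    change crossedRep A σ (e _) = _
    congr 1
    apply Subtype.ext
    change E (entry (crossedRep A σ a) 1 1) = _
    rw [entry_crossedRep_self, inv_one, action_one, hE.map_of_mem _ a.2]
  · intro T hT
    exact isPositive_crossedRep (hE.map_nonneg _ (isPositive_entry_self hT 1))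
  · intro x hx y hy T
    obtain ⟨a, rfl⟩ := (hmem x).1 hx
    obtain ⟨b, rfl⟩ := (hmem y).1 hy
    change crossedRep A σ (e _) = _ * crossedRep A σ (e T) * _
    rw [he, crossedRep_mul, crossedRep_mul]

theorem isInvariantAmenableSubalgebra_crossedProduct_bot
    (hσ : ∀ g a, A.trace (σ g a) = A.trace a) (hA : A.alg.IsAmenable) :
    IsInvariantAmenableSubalgebra A σ (crossedProduct A σ (⊥ : Subgroup Γ)) :=
  ⟨crossedProduct_mono σ bot_le, isConjInvariant_crossedProduct_bot hσ,
    isAmenable_crossedProduct_bot hσ hA⟩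

end TrivialSubgroup

end

theorem theorem6 {Γ : Type v} [Group Γ] [Countable Γ]
    {K : Type u} [NormedAddCommGroup K] [InnerProductSpace ℂ K] [CompleteSpace K]
    [TopologicalSpace.SeparableSpace K]
    (A : TracialVonNeumannAlgebra K) (hA : A.alg.IsAmenable)
    (σ : Γ →* (A.Elem ≃⋆ₐ[ℂ] A.Elem)) (hσ : ∀ g a, A.trace (σ g a) = A.trace a) :
    (∀ N : VonNeumannAlgebra (L2 Γ K), IsInvariantAmenableSubalgebra A σ N →
      Set.range (crossedRep A σ) ⊆ (N : Set (L2 Γ K →L[ℂ] L2 Γ K)) →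
      N ≤ crossedProduct A σ (amenableRadical Γ)) ∧
    (amenableRadical Γ = ⊥ →
      ∃ B : VonNeumannAlgebra (L2 Γ K),
        (B : Set (L2 Γ K →L[ℂ] L2 Γ K)) = Set.range (crossedRep A σ) ∧
        Maximal (IsInvariantAmenableSubalgebra A σ) B) := by
  refine ⟨fun N hN _ => hN.le_crossedProduct_amenableRadical hσ, fun hrad => ?_⟩
  refine ⟨crossedProduct A σ ⊥, coe_crossedProduct_bot hσ,
    isInvariantAmenableSubalgebra_crossedProduct_bot hσ hA, fun N hN _ => ?_⟩
  rw [← hrad]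
  exact hN.le_crossedProduct_amenableRadical hσ
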